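/- Let $\Lambda$ be a countable set, $m\ge 0$ an integer, $c_c(\Lambda)$ the space of finitely supported functions $\Lambda\to\mathbb C$, in duality with $\mathbb C^\Lambda$ by $\langle \xi,a\rangle=\sum_\lambda \xi_\lambda a_\lambda$; for $J\subset c_c(\Lambda)$ let $J^\perp\subset\mathbb C^\Lambda$ be its orthogonal. Let $\mathrm{Gr}_m(\Lambda)$ be the set of subspaces $J\subset c_c(\Lambda)$ of codimension $m$, with the topology induced by the Grassmann embedding $J\mapsto[\xi_1\wedge\dots\wedge\xi_m]$ ($\xi$ a basis of $J^\perp$) into the projective space $\mathbb P(\wedge^m\mathbb C^\Lambda)$, where $\wedge^m\mathbb C^\Lambda$ has the weak topology from its duality with $\wedge^m c_c(\Lambda)$. Let $\mathbf H_m(\Lambda)$ be the set of positive Hermitian matrices $\rho=(\rho_{\lambda\mu})_{\lambda,\mu\in\Lambda}$ of rank $m$, i.e. such that, with $\langle a,b\rangle_\rho=\sum\rho_{\lambda\mu}\bar a_\lambda b_\mu$ and $J_\rho=\{a\in c_c(\Lambda):\sum_\mu\rho_{\lambda\mu}a_\mu=0\ \forall\lambda\}=\{a:\langle a,a\rangle_\rho=0\}$,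 the quotient $c_c(\Lambda)/J_\rho$ has dimension $m$; it carries the topology of entrywise convergence. Smooth maps between open subsets of Fréchet spaces are meant in the sense of Michal–Bastiani–Hamilton (iterated directional derivatives exist and are jointly continuous). Then: 0) $\mathrm{Gr}_m(\Lambda)$ is a (Hausdorff, smooth) Fréchet manifold. An atlas is given by the charts indexed by $J\in\mathrm{Gr}_m(\Lambda)$ and a supplement $J'$ of $J$: with $H=J^\perp$, $H'=J'^\perp$, the domain is $\{K: K^\perp\cap H'=0\}$ and $K$ is sent to the linear map $T:H\to H'$ whose graph $\{\xi+T\xi:\xi\in H\}$ is $K^\perp$; the chart is onto the Fréchet space of all linear maps $H\to H'$. 1) The quotients $\mathbf S(J)=c_c(\Lambda)/J$ form a smooth complex vector bundle $\mathbf S$ of dimension $m$ over $\mathrm{Gr}_m(\Lambda)$, whose trivializations include, for each linearly independent family $v=(v_1,\dots,v_m)$ in $c_c(\Lambda)$, the one over $U_v=\{J: J^\perp\cap \mathrm{span}(v)^\perp=0\}$ which sends the class of $\sum_i x_iv_i$ in $\mathbf S(J)$ to $(J,x)\in U_v\times\mathbb C^m$. 2) For each $J$, the Hermitian forms on $\mathbf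 S(J)$ form a real vector space of dimension $m^2$, in which the non-degenerate positive ones form an open convex cone, and $\rho\mapsto\big(([a],[b])\mapsto\langle a,b\rangle_\rho\big)$ is a homeomorphism from $\{\rho\in\mathbf H_m(\Lambda):J_\rho=J\}$ onto this cone. Moreover $\mathbf H_m(\Lambda)$ is a Fréchet manifold, smoothly embedded in the Fréchet space $\mathbb C^{\Lambda\times\Lambda}$ (the inclusion is a smooth topological embedding and charts are locally restrictions of smooth maps on open sets of $\mathbb C^{\Lambda\times\Lambda}$), and the map $j:\mathbf H_m(\Lambda)\to\mathrm{Gr}_m(\Lambda)$, $j(\rho)=J_\rho$, is a smooth locally trivial fibration with this fiber: the sets $U_v$ cover $\mathrm{Gr}_m(\Lambda)$, and, for each $v$ as in 1), $\rho\mapsto\big(J_\rho,\ (x,y)\mapsto\langle\sum_i x_iv_i,\sum_i y_iv_i\rangle_\rho\big)$ is a diffeomorphism from $j^{-1}(U_v)$ onto the product of $U_v$ with the cone of non-degenerate positive Hermitian forms on $\mathbb C^m$. -/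

import Mathlib

open Set Filter Topology Bundle
open scoped ComplexConjugate

universe u v w

noncomputable section

/-! ### Differential calculus on Fréchet spaces and Fréchet manifolds -/

/-- A real Fréchet space: a locally convex topological vector space which is completely
metrizable (in particular Hausdorff). -/
structure IsFrechetSpace (E : Type u) [AddCommGroup E] [Module ℝ E] [TopologicalSpace E] :
    Prop where
  topologicalAddGroup : IsTopologicalAddGroup E
  continuousSMul : ContinuousSMul ℝ E
  locallyConvex : LocallyConvexSpace ℝ E
  completelyMetrizable : TopologicalSpace.IsCompletelyMetrizableSpace E

/-- `C^n` maps on an open set `U` of a topological vector space, in the sense of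
Michal, Bastiani and Hamilton: `f` is `C^0` if it is continuous; `f` is `C^(n+1)` if it is
continuous, the directional derivative `df (x, v) = lim_{t → 0} (f (x + t v) - f x) / t` exists for
all `x ∈ U` and all `v`, and `df` is `C^n` on `U × E`. -/
def CkOn {F : Type v} [AddCommGroup F] [Module ℝ F] [TopologicalSpace F] :
    ℕ → ∀ {E : Type u} [AddCommGroup E] [Module ℝ E] [TopologicalSpace E],
      (E → F) → Set E → Prop
  | 0, _, _, _, _, f, U => ContinuousOn f U
  | n + 1, E, _, _, _, f, U =>
      ContinuousOn f U ∧ ∃ df : E × E → F,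
        (∀ x ∈ U, ∀ v : E,
          Tendsto (fun t : ℝ => t⁻¹ • (f (x + t • v) - f x)) (𝓝[≠] 0) (𝓝 (df (x, v)))) ∧
        CkOn n df (U ×ˢ (univ : Set E))

/-- Smooth maps on an open set `U` of a topological vector space. -/
def SmoothOn {E : Type u} [AddCommGroup E] [Module ℝ E] [TopologicalSpace E]
    {F : Type v} [AddCommGroup F] [Module ℝ F] [TopologicalSpace F] (f : E → F) (U : Set E) :
    Prop :=
  ∀ n : ℕ, CkOn n f U

section Manifolds

variable {M : Type*} [TopologicalSpace M] {ι : Type*} {E : ι → Type*}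
  [∀ i, AddCommGroup (E i)] [∀ i, Module ℝ (E i)] [∀ i, TopologicalSpace (E i)]
  {N : Type*} [TopologicalSpace N] {κ : Type*} {F : κ → Type*}
  [∀ k, AddCommGroup (F k)] [∀ k, Module ℝ (F k)] [∀ k, TopologicalSpace (F k)]

/-- The charts `φ i`, with values in the spaces `E i`, form an atlas which makes the topological
space `M` a (smooth, Hausdorff) Fréchet manifold. -/
structure IsFrechetManifold (φ : ∀ i, OpenPartialHomeomorph M (E i)) : Prop where
  t2 : T2Space M
  frechet : ∀ i, IsFrechetSpace (E i)
  cover : ∀ x : M, ∃ i, x ∈ (φ i).source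
  smooth_transition : ∀ i j,
    SmoothOn (fun t => φ j ((φ i).symm t)) ((φ i).target ∩ (φ i).symm ⁻¹' (φ j).source)

/-- The map `f` is smooth on the open set `s`, relative to the atlases `φ` of `M` and `ψ` of `N`. -/
def SmoothMapOn (φ : ∀ i, OpenPartialHomeomorph M (E i)) (ψ : ∀ k, OpenPartialHomeomorph N (F k))
    (f : M → N) (s : Set M) : Prop :=
  ContinuousOn f s ∧ ∀ i k,
    SmoothOn (fun t => ψ k (f ((φ i).symm t)))
      ((φ i).target ∩ (φ i).symm ⁻¹' (s ∩ f ⁻¹' (ψ k).source))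

/-- The product atlas. -/
def prodCharts (φ : ∀ i, OpenPartialHomeomorph M (E i))
    (ψ : ∀ k, OpenPartialHomeomorph N (F k)) :
    ∀ p : ι × κ, OpenPartialHomeomorph (M × N) (E p.1 × F p.2) :=
  fun p => (φ p.1).prod (ψ p.2)

/-- The atlas of a topological vector space with the identity as its only chart. -/
def selfChart (V : Type*) [TopologicalSpace V] : Unit → OpenPartialHomeomorph V V :=
  fun _ => OpenPartialHomeomorph.refl V

/-- The smooth structure of `M` given by the atlas `φ` is the one induced from the topological
vector space `V` by the map `incl`: this map is a topological embedding, it is smooth, and every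
chart of `M` is locally the restriction of a smooth map on an open set of `V`. -/
structure IsSmoothEmbedding (φ : ∀ i, OpenPartialHomeomorph M (E i)) {V : Type*}
    [AddCommGroup V] [Module ℝ V] [TopologicalSpace V] (incl : M → V) : Prop where
  embedding : IsEmbedding incl
  smooth : SmoothMapOn φ (selfChart V) incl univ
  extend : ∀ i, ∀ x ∈ (φ i).source, ∃ W : Set V, IsOpen W ∧ incl x ∈ W ∧ ∃ g : V → E i,
    SmoothOn g W ∧ ∀ y ∈ (φ i).source, incl y ∈ W → g (incl y) = φ i y

/-- A topological complex vector bundle `S` over `M`, with typical fiber `G`, is smooth (relative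
to the atlas `φ` of `M`) if all coordinate changes between trivializations of its atlas are smooth
functions with values in the endomorphisms of `G`. -/
def IsSmoothVectorBundle (φ : ∀ i, OpenPartialHomeomorph M (E i))
    (G : Type*) [NormedAddCommGroup G] [NormedSpace ℂ G] (S : M → Type*)
    [∀ x, AddCommGroup (S x)] [∀ x, Module ℂ (S x)] [TopologicalSpace (TotalSpace G S)]
    [∀ x, TopologicalSpace (S x)] [FiberBundle G S] [VectorBundle ℂ G S] : Prop :=
  ∀ (e e' : Trivialization G (TotalSpace.proj : TotalSpace G S → M))
    [MemTrivializationAtlas e] [MemTrivializationAtlas e'] (i : ι),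
    SmoothOn (fun t => (e.coordChangeL ℂ e' ((φ i).symm t) : G →L[ℂ] G))
      ((φ i).target ∩ (φ i).symm ⁻¹' (e.baseSet ∩ e'.baseSet))

end Manifolds

/-! ### Hermitian forms -/

/-- The real vector space of Hermitian forms on `V`, antilinear in the first variable. -/
def HermForm (V : Type u) [AddCommGroup V] [Module ℂ V] :
    Submodule ℝ (V →ₗ⋆[ℂ] V →ₗ[ℂ] ℂ) where
  carrier := {h | ∀ x y, h y x = conj (h x y)}
  add_mem' := by
    intro h k hh hk x y
    simp [hh x y, hk x y]
  zero_mem' := by intro x y; simp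
  smul_mem' := by
    intro c h hh x y
    simp [hh x y]

/-- The topology of pointwise convergence of Hermitian forms; if `V` is finite dimensional, it is
the usual topology of the finite-dimensional real vector space of Hermitian forms. -/
instance (V : Type u) [AddCommGroup V] [Module ℂ V] : TopologicalSpace (HermForm V) :=
  TopologicalSpace.induced (fun (h : HermForm V) (x y : V) => h.1 x y) inferInstance

/-- The cone of non-degenerate positive Hermitian forms on `V`. -/
def posCone (V : Type u) [AddCommGroup V] [Module ℂ V] : Set (HermForm V) :=
  {h | (∀ x, 0 ≤ (h.1 x x).re) ∧ ∀ x, (∀ y, h.1 x y = 0) → x = 0}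

/-! ### The Grassmannian -/

/-- The Grassmannian of all subspaces of codimension `m` of the space `c_c(Λ) = Λ →₀ ℂ` of
finitely supported sequences. -/
def Gr (m : ℕ) (Λ : Type u) : Type u :=
  {J : Submodule ℂ (Λ →₀ ℂ) //
    FiniteDimensional ℂ ((Λ →₀ ℂ) ⧸ J) ∧ Module.finrank ℂ ((Λ →₀ ℂ) ⧸ J) = m}

/-- The fiber `S(J) = c_c(Λ) / J`. -/
abbrev quotFiber (m : ℕ) (Λ : Type u) (J : Gr m Λ) : Type u := (Λ →₀ ℂ) ⧸ J.1

/-- The orthogonal of a subspace of `c_c(Λ)` in `ℂ^Λ`, for the bilinear duality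
`(ξ, a) ↦ ∑ ξ_λ a_λ`. -/
def perp {Λ : Type u} (J : Submodule ℂ (Λ →₀ ℂ)) : Submodule ℂ (Λ → ℂ) where
  carrier := {ξ | ∀ a ∈ J, (a.sum fun l x => ξ l * x) = 0}
  add_mem' := by
    intro ξ η hξ hη a ha
    have h1 := hξ a ha
    have h2 := hη a ha
    simp only [Finsupp.sum] at h1 h2 ⊢
    simp [add_mul, Finset.sum_add_distrib, h1, h2]
  zero_mem' := by intro a _; simp
  smul_mem' := by
    intro c ξ hξ a ha
    have h1 := hξ a ha
    simp only [Finsupp.sum] at h1 ⊢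
    simp [mul_assoc, ← Finset.mul_sum, h1]

instance {Λ : Type u} (J : Submodule ℂ (Λ →₀ ℂ)) : ContinuousConstSMul ℝ (perp J) where
  continuous_const_smul c := by
    refine Continuous.subtype_mk (f := fun ξ : perp J => c • (ξ : Λ → ℂ)) ?_ _
    fun_prop

/-- The Grassmann coordinates of `ξ_1 ∧ ⋯ ∧ ξ_m`: its pairings
`det (ξ_i (f j))` with the elements `δ_{f 1} ∧ ⋯ ∧ δ_{f m}`, which span the exterior power
`⋀^m c_c(Λ)`. -/
def grassmannCoord {m : ℕ} {Λ : Type u} (ξ : Fin m → Λ → ℂ) : (Fin m → Λ) → ℂ :=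
  fun f => Matrix.det (Matrix.of fun i j => ξ i (f j))

/-- Every `m`-dimensional subspace `H = J^⊥` has a basis, and its Grassmann coordinates do not all
vanish. -/
theorem Gr.exists_basis {m : ℕ} {Λ : Type u} (J : Gr m Λ) :
    ∃ ξ : Fin m → Λ → ℂ, LinearIndependent ℂ ξ ∧ Submodule.span ℂ (range ξ) = perp J.1 ∧
      grassmannCoord ξ ≠ 0 := by
  classical
  have := J.2.1
  let b := Module.finBasisOfFinrankEq ℂ ((Λ →₀ ℂ) ⧸ J.1) J.2.2
  let ξ : Fin m → Λ → ℂ := fun i l => b.coord i (J.1.mkQ (Finsupp.single l 1))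
  have hpair : ∀ (i : Fin m) (a : Λ →₀ ℂ),
      (a.sum fun l x => ξ i l * x) = b.coord i (J.1.mkQ a) := by
    intro i a
    have h : Finsupp.linearCombination ℂ (ξ i) = (b.coord i).comp J.1.mkQ := by
      ext l
      simp [ξ]
    have h2 := LinearMap.congr_fun h a
    rw [Finsupp.linearCombination_apply] at h2
    simpa [mul_comm] using h2
  choose a ha using fun i => J.1.mkQ_surjective (b i)
  refine ⟨ξ, ?_, ?_, ?_⟩
  · rw [Fintype.linearIndependent_iff]
    intro c hc i
    have h : (∑ k, c k * ((a i).sum fun l x => ξ k l * x)) = 0 := by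
      simp only [Finsupp.sum, Finset.mul_sum]
      rw [Finset.sum_comm]
      refine Finset.sum_eq_zero fun l _ => ?_
      have h3 := congr_fun hc l
      simp only [Finset.sum_apply, Pi.smul_apply, smul_eq_mul, Pi.zero_apply] at h3
      rw [← zero_mul (a i l), ← h3, Finset.sum_mul]
      exact Finset.sum_congr rfl fun _ _ => by ring
    simp only [hpair, ha] at h
    simpa [Finsupp.single_apply] using h
  · apply le_antisymm
    · rw [Submodule.span_le]
      rintro _ ⟨i, rfl⟩ c hc
      rw [hpair, (Submodule.mkQ_apply J.1 c).trans ((Submodule.Quotient.mk_eq_zero _).2 hc),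
        map_zero]
    · intro η hη
      have h : η = ∑ i, (Finsupp.linearCombination ℂ η (a i)) • ξ i := by
        ext l
        have hmem : Finsupp.single l 1 - ∑ i, ξ i l • a i ∈ J.1 := by
          rw [← Submodule.Quotient.mk_eq_zero, ← Submodule.mkQ_apply, map_sub, map_sum]
          simp only [map_smul, ha, ξ]
          rw [sub_eq_zero]
          exact (b.sum_repr _).symm
        have h4 := hη _ hmem
        have h5 : Finsupp.linearCombination ℂ η (Finsupp.single l 1 - ∑ i, ξ i l • a i) = 0 := by
          rw [Finsupp.linearCombination_apply, ← h4]
          exact Finsupp.sum_congr fun _ _ => by simp [mul_comm]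
        rw [map_sub, map_sum, sub_eq_zero] at h5
        simpa [mul_comm] using h5
      rw [h]
      exact Submodule.sum_mem _ fun i _ => Submodule.smul_mem _ _ (Submodule.subset_span ⟨i, rfl⟩)
  · intro h0
    have h : (b.det.toMultilinearMap.compLinearMap fun _ : Fin m => J.1.mkQ) = 0 := by
      refine Module.Basis.ext_multilinear (fun _ => Finsupp.basisSingleOne) fun f => ?_
      have h1 := congr_fun h0 f
      simp only [MultilinearMap.compLinearMap_apply, Finsupp.coe_basisSingleOne,
        AlternatingMap.coe_multilinearMap, zero_apply]
      rw [Module.Basis.det_apply]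
      exact h1
    have h1 := congr_arg (fun g => g a) h
    simp only [MultilinearMap.compLinearMap_apply, ha, AlternatingMap.coe_multilinearMap,
      zero_apply] at h1
    rw [show (fun i => b i) = b from rfl, b.det_self] at h1
    exact one_ne_zero h1

/-- The Grassmann embedding `J ↦ [ξ_1 ∧ ⋯ ∧ ξ_m]`, for a basis `ξ` of `J^⊥`, into the projective
space of the space of Grassmann coordinates. -/
def Gr.plucker {m : ℕ} {Λ : Type u} (J : Gr m Λ) : Projectivization ℂ ((Fin m → Λ) → ℂ) :=
  Projectivization.mk ℂ (grassmannCoord J.exists_basis.choose) J.exists_basis.choose_spec.2.2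

/-- The quotient topology on a projective space. -/
instance projTopology (V : Type u) [AddCommGroup V] [Module ℂ V] [TopologicalSpace V] :
    TopologicalSpace (Projectivization ℂ V) :=
  TopologicalSpace.coinduced (Projectivization.mk' ℂ) inferInstance

/-- The topology of the Grassmannian as a subset of the projective space, where Grassmann
coordinates carry the weak topology, i.e. the topology of pointwise convergence. -/
instance (m : ℕ) (Λ : Type u) : TopologicalSpace (Gr m Λ) :=
  TopologicalSpace.induced Gr.plucker inferInstance

/-- The set of `K` such that `K^⊥` intersects `J'^⊥` trivially. -/
def chartDomain {m : ℕ} {Λ : Type u} (J' : Submodule ℂ (Λ →₀ ℂ)) : Set (Gr m Λ) :=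
  {K | perp K.1 ⊓ perp J' = ⊥}

/-- The index set of the charts: `J` in the Grassmannian together with a supplement `J'`. -/
structure ChartIdx (m : ℕ) (Λ : Type u) where
  J : Gr m Λ
  J' : Submodule ℂ (Λ →₀ ℂ)
  isCompl : IsCompl J.1 J'

/-- The model space of the chart given by `(J, J')`: the linear maps from `H = J^⊥` to
`H' = J'^⊥` (they are all continuous because `H` has finite dimension). -/
def ChartIdx.Model {m : ℕ} {Λ : Type u} (p : ChartIdx m Λ) : Type u :=
  perp p.J.1 →L[ℂ] perp p.J'

/-- An element of the model space, as a linear map. -/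
def ChartIdx.Model.toCLM {m : ℕ} {Λ : Type u} {p : ChartIdx m Λ} (T : p.Model) :
    perp p.J.1 →L[ℂ] perp p.J' := T

instance {m : ℕ} {Λ : Type u} (p : ChartIdx m Λ) : AddCommGroup p.Model :=
  inferInstanceAs (AddCommGroup (perp p.J.1 →L[ℂ] perp p.J'))

instance {m : ℕ} {Λ : Type u} (p : ChartIdx m Λ) : Module ℝ p.Model :=
  inferInstanceAs (Module ℝ (perp p.J.1 →L[ℂ] perp p.J'))

instance {m : ℕ} {Λ : Type u} (p : ChartIdx m Λ) : TopologicalSpace p.Model :=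
  inferInstanceAs (TopologicalSpace (perp p.J.1 →L[ℂ] perp p.J'))

/-- `J` in the Grassmannian together with a basis `v` of a supplement of `J`. -/
structure FrameIdx (m : ℕ) (Λ : Type u) where
  J : Gr m Λ
  v : Fin m → (Λ →₀ ℂ)
  linearIndependent : LinearIndependent ℂ v
  isCompl : IsCompl J.1 (Submodule.span ℂ (range v))

/-- The chart index given by a frame. -/
def FrameIdx.toChartIdx {m : ℕ} {Λ : Type u} (q : FrameIdx m Λ) : ChartIdx m Λ :=
  ⟨q.J, Submodule.span ℂ (range q.v), q.isCompl⟩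

/-! ### Positive Hermitian forms of rank `m` on `c_c(Λ)` -/

/-- The inner product `⟨a, b⟩ = ∑ ρ_{λμ} conj(a_λ) b_μ`. -/
def rhoInner {Λ : Type u} (ρ : Matrix Λ Λ ℂ) (a b : Λ →₀ ℂ) : ℂ :=
  a.sum fun l x => b.sum fun k y => conj x * ρ l k * y

/-- The radical `J_ρ`: the vectors `a` orthogonal to the lines of `ρ`. -/
def radical {Λ : Type u} (ρ : Matrix Λ Λ ℂ) : Submodule ℂ (Λ →₀ ℂ) where
  carrier := {a | ∀ l, (a.sum fun k y => ρ l k * y) = 0}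
  add_mem' := by
    intro a b ha hb l
    rw [Finsupp.sum_add_index' (by simp) (by intros; ring), ha l, hb l, add_zero]
  zero_mem' := by intro l; simp
  smul_mem' := by
    intro c a ha l
    rw [Finsupp.sum_smul_index' (by simp)]
    have h := ha l
    simp only [Finsupp.sum, smul_eq_mul] at h ⊢
    rw [← mul_zero c, ← h, Finset.mul_sum]
    exact Finset.sum_congr rfl fun _ _ => by ring

open scoped ComplexOrder in
/-- For a positive Hermitian form, the radical consists of the vectors of length zero. -/
theorem mem_radical_iff {Λ : Type u} {ρ : Matrix Λ Λ ℂ} (hρ : ρ.PosSemidef) (a : Λ →₀ ℂ) :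
    a ∈ radical ρ ↔ rhoInner ρ a a = 0 := by
  classical
  constructor
  · intro ha
    refine Finset.sum_eq_zero fun l _ => ?_
    have h := ha l
    simp only [Finsupp.sum] at h ⊢
    simp only [mul_assoc, ← Finset.mul_sum, h, mul_zero]
  · intro ha l
    have addl : ∀ b c d, rhoInner ρ (b + c) d = rhoInner ρ b d + rhoInner ρ c d := by
      intro b c d
      refine Finsupp.sum_add_index' (by simp) fun i x y => ?_
      simp only [Finsupp.sum, map_add, add_mul, Finset.sum_add_distrib]
    have addr : ∀ b c d, rhoInner ρ d (b + c) = rhoInner ρ d b + rhoInner ρ d c := by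
      intro b c d
      simp only [rhoInner]
      rw [← Finsupp.sum_add]
      refine Finsupp.sum_congr fun i _ => ?_
      exact Finsupp.sum_add_index' (by simp) (by intros; ring)
    have smull : ∀ (z : ℂ) b d, rhoInner ρ (z • b) d = conj z * rhoInner ρ b d := by
      intro z b d
      simp only [rhoInner]
      rw [Finsupp.sum_smul_index' (by simp)]
      simp only [Finsupp.sum, Finset.mul_sum, smul_eq_mul, map_mul, mul_assoc]
    have smulr : ∀ (z : ℂ) b d, rhoInner ρ d (z • b) = z * rhoInner ρ d b := by
      intro z b d
      simp only [rhoInner, Finsupp.sum, Finset.mul_sum]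
      refine Finset.sum_congr rfl fun i _ => ?_
      have h := Finsupp.sum_smul_index' (g := b) (b := z)
        (h := fun k y => conj (d i) * ρ i k * y) (by simp)
      simp only [Finsupp.sum] at h
      rw [h]
      exact Finset.sum_congr rfl fun _ _ => by rw [smul_eq_mul]; ring
    have symm : ∀ b d, rhoInner ρ d b = conj (rhoInner ρ b d) := by
      intro b d
      simp only [rhoInner, Finsupp.sum, map_sum, map_mul, Complex.conj_conj]
      rw [Finset.sum_comm]
      refine Finset.sum_congr rfl fun i _ => Finset.sum_congr rfl fun k _ => ?_
      have h : conj (ρ i k) = ρ k i := hρ.1.apply k i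
      rw [h]
      ring
    set e : Λ →₀ ℂ := Finsupp.single l 1 with he
    have key : rhoInner ρ e a = 0 := by
      by_contra hne
      set w := rhoInner ρ e a with hw
      have hpos : 0 < Complex.normSq w := Complex.normSq_pos.2 hne
      set r : ℝ := (rhoInner ρ e e).re with hr
      have hall : ∀ t : ℝ, 0 ≤ r - 2 * t * Complex.normSq w := by
        intro t
        have h := hρ.2 (e + (-(t : ℂ) * conj w) • a)
        have h' : 0 ≤ rhoInner ρ (e + (-(t : ℂ) * conj w) • a) (e + (-(t : ℂ) * conj w) • a) := h
        rw [addl, addr, addr, smull, smull, smulr, smulr, ha, symm e a, ← hw] at h'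
        have h'' := (Complex.le_def.1 h').1
        simp only [Complex.zero_re, Complex.add_re, Complex.mul_re, Complex.mul_im,
          Complex.neg_re, Complex.neg_im, Complex.ofReal_re, Complex.ofReal_im, map_mul, map_neg,
          Complex.conj_conj, Complex.conj_ofReal, Complex.conj_re, Complex.conj_im,
          Complex.zero_im] at h''
        rw [Complex.normSq_apply]
        rw [← hr] at h''
        linarith
      have h := hall ((r + 1) / (2 * Complex.normSq w))
      have h2 : 2 * ((r + 1) / (2 * Complex.normSq w)) * Complex.normSq w = r + 1 := by
        field_simp
      rw [h2] at h
      linarith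
    have h : rhoInner ρ e a = a.sum fun k y => ρ l k * y := by
      rw [he, rhoInner, Finsupp.sum_single_index (by simp)]
      simp
    rw [← h, key]

open scoped ComplexOrder in
/-- The space `H_m(Λ)` of positive Hermitian forms of rank `m`: the quotient of `c_c(Λ)` by the
radical has dimension `m`. -/
def HForm (m : ℕ) (Λ : Type u) : Type u :=
  {ρ : Matrix Λ Λ ℂ // ρ.PosSemidef ∧ FiniteDimensional ℂ ((Λ →₀ ℂ) ⧸ radical ρ) ∧
    Module.finrank ℂ ((Λ →₀ ℂ) ⧸ radical ρ) = m}

/-- The topology of entrywise convergence. -/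
instance (m : ℕ) (Λ : Type u) : TopologicalSpace (HForm m Λ) :=
  TopologicalSpace.induced (fun ρ => ρ.1) (inferInstance : TopologicalSpace (Matrix Λ Λ ℂ))

/-- The map `j : ρ ↦ J_ρ`. -/
def HForm.j {m : ℕ} {Λ : Type u} (ρ : HForm m Λ) : Gr m Λ := ⟨radical ρ.1, ρ.2.2⟩

end

noncomputable section

/-! ### Calculus in topological vector spaces -/

section Calculus

open scoped ContDiff

/-! A subspace of codimension `m` is the kernel of a surjection `c_c(Λ) → ℂ^m`, that is, of an `m ×
Λ` matrix `A` whose rows form a basis of `J^⊥`; the matrix is unique up to left multiplication by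
`GL_m`. Let `pair A v` be the `m × m` matrix of pairings of the rows with a family `v`. Then `J`
lies in `U_v` exactly when `det (pair A v) ≠ 0` (`Represents.mem_chartDomain_iff`), and in that case
`(pair A v)⁻¹ A` is the only matrix of `J` dual to `v`. This normalized matrix is `Gr.frameMat`.

By Cramer's rule (`inv_pair_mul_apply`) its entries are quotients of two linear functionals of the
Grassmann coordinates, so they are continuous on `U_v`; conversely, Grassmann coordinates are minors
of the matrix. The topology of `U_v` is thus entrywise convergence of `frameMat`. If `v` is a basis
of `J'` and `B` the basis of `J^⊥` dual to it, the linear map with graph `K^⊥` has matrix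
`K.frameMat v - B`, which can be any matrix with rows in `J'^⊥`.

Changing charts replaces `A` by `(pair A w)⁻¹ A`. Each entry of the result is a rational function of
finitely many entries of `A`, so smoothness in the sense of Michal, Bastiani and Hamilton reduces to
finite-dimensional calculus (`CylSmoothOn`, `CkOn.of_contDiffOn`). The model spaces are retracts of
spaces `ℂ^ι` (`Coords`): this makes them Fréchet and lets smoothness be tested on coordinates. The
coordinate changes of the quotient bundle are the matrices `pair (J.frameMat w) v`.

For a positive form `ρ` and a family `v`, let `R` be the matrix of the products `⟨v_i, δ_λ⟩_ρ` and
`G = pair R v` the Gram matrix. By positivity, `J_ρ ∈ U_v` if and only if `det G ≠ 0`, and then the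
normalized matrix of `J_ρ` is `N = G⁻¹ R` (`HForm.frameMat_j`). Conversely `ρ` is recovered from `N`
and the form `h` induced on `ℂ^m` as `N* h N` (`HForm.ofFrame_apply`). Both directions are again
given by finitely many entries at a time, and `G⁻¹ R` makes sense for every matrix near `ρ`,
Hermitian or not. This yields at once the trivialization of `j`, its smoothness and the local
extension of the charts to open sets of `ℂ^{Λ×Λ}`. -/

theorem tendsto_add_smul_zero {E : Type*} [AddCommGroup E] [Module ℝ E] [TopologicalSpace E]
    [ContinuousAdd E] [ContinuousSMul ℝ E] (x v : E) :
    Tendsto (fun t : ℝ => x + t • v) (𝓝[≠] 0) (𝓝 x) := by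
  have h : Continuous fun t : ℝ => x + t • v := by fun_prop
  have h0 := h.tendsto 0
  simp only [zero_smul, add_zero] at h0
  exact h0.mono_left nhdsWithin_le_nhds

/-- Maps which agree on an open set are simultaneously of class `C^n`. -/
theorem CkOn.congr {F : Type v} [AddCommGroup F] [Module ℝ F] [TopologicalSpace F]
    {E : Type u} [AddCommGroup E] [Module ℝ E] [TopologicalSpace E]
    [ContinuousAdd E] [ContinuousSMul ℝ E] {n : ℕ} {f g : E → F} {U : Set E} (hU : IsOpen U)
    (h : CkOn n f U) (hfg : EqOn g f U) : CkOn n g U := by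
  cases n with
  | zero => exact ContinuousOn.congr h hfg
  | succ n =>
    obtain ⟨hc, df, hd, hdf⟩ := h
    refine ⟨hc.congr hfg, df, fun x hx v => ?_, hdf⟩
    refine (hd x hx v).congr' ?_
    filter_upwards [(tendsto_add_smul_zero x v).eventually (hU.mem_nhds hx)] with t ht
    rw [hfg ht, hfg hx]

theorem SmoothOn.congr {F : Type v} [AddCommGroup F] [Module ℝ F] [TopologicalSpace F]
    {E : Type u} [AddCommGroup E] [Module ℝ E] [TopologicalSpace E]
    [ContinuousAdd E] [ContinuousSMul ℝ E] {f g : E → F} {U : Set E} (hU : IsOpen U)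
    (h : SmoothOn f U) (hfg : EqOn g f U) : SmoothOn g U := fun n => (h n).congr hU hfg

/-- A continuous linear map composed with a map of class `C^n`. -/
theorem CkOn.clm_comp {F : Type v} [AddCommGroup F] [Module ℝ F] [TopologicalSpace F]
    {F' : Type w} [AddCommGroup F'] [Module ℝ F'] [TopologicalSpace F'] (r : F →L[ℝ] F')
    {n : ℕ} : ∀ {E : Type u} [AddCommGroup E] [Module ℝ E] [TopologicalSpace E]
    {f : E → F} {U : Set E}, CkOn n f U → CkOn n (fun x => r (f x)) U := by
  -- The derivative is a function on `E × E`, so the induction has to treat all domains at once.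
  induction n with
  | zero => exact fun h => r.continuous.comp_continuousOn h
  | succ n ih =>
    intro E _ _ _ f U h
    obtain ⟨hc, df, hd, hdf⟩ := h
    refine ⟨r.continuous.comp_continuousOn hc, fun p => r (df p), fun x hx v => ?_, ih hdf⟩
    refine ((r.continuous.tendsto _).comp (hd x hx v)).congr fun t => ?_
    simp

/-- A map into a product is of class `C^n` if its coordinates are. -/
theorem CkOn.pi {ι : Type w} {F : Type v} [AddCommGroup F] [Module ℝ F] [TopologicalSpace F]
    {n : ℕ} : ∀ {E : Type u} [AddCommGroup E] [Module ℝ E] [TopologicalSpace E]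
    {f : E → ι → F} {U : Set E}, (∀ i, CkOn n (fun x => f x i) U) → CkOn n f U := by
  induction n with
  | zero => exact fun h => continuousOn_pi.2 h
  | succ n ih =>
    intro E _ _ _ f U h
    choose hc df hd hdf using h
    refine ⟨continuousOn_pi.2 hc, fun p i => df i p, fun x hx v => ?_, ih hdf⟩
    exact tendsto_pi_nhds.2 fun i => hd i x hx v

/-- A smooth map of a normed space composed with a continuous linear map. -/
theorem CkOn.of_contDiffOn {G : Type v} [NormedAddCommGroup G] [NormedSpace ℝ G] {n : ℕ} :
    ∀ {E : Type u} [AddCommGroup E] [Module ℝ E] [TopologicalSpace E]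
      {N : Type w} [NormedAddCommGroup N] [NormedSpace ℝ N] {g : N → G} {W : Set N}
      (L : E →L[ℝ] N) {U : Set E}, IsOpen W → ContDiffOn ℝ ∞ g W → MapsTo L U W →
      CkOn n (fun x => g (L x)) U := by
  induction n with
  | zero =>
    intro E _ _ _ N _ _ g W L U hW hg hL
    exact hg.continuousOn.comp L.continuous.continuousOn hL
  | succ n ih =>
    intro E _ _ _ N _ _ g W L U hW hg hL
    refine ⟨hg.continuousOn.comp L.continuous.continuousOn hL,
      fun p => fderiv ℝ g (L p.1) (L p.2), fun x hx v => ?_, ?_⟩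
    · have hd : HasFDerivAt g (fderiv ℝ g (L x)) (L x) :=
        ((hg.contDiffAt (hW.mem_nhds (hL hx))).differentiableAt (by simp)).hasFDerivAt
      simpa using (hd.hasLineDerivAt (L v)).tendsto_slope_zero
    · have h1 : ContDiffOn ℝ ∞ (fun q : N × N => fderiv ℝ g q.1 q.2) (W ×ˢ univ) := by
        refine ContDiffOn.clm_apply ?_ contDiff_snd.contDiffOn
        exact (hg.fderiv_of_isOpen hW (by simp)).comp contDiff_fst.contDiffOn fun q hq => hq.1
      -- The derivative has the same shape: `(y, w) ↦ Dg(y) w` on `W × N`, composed with `L × L`.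
      exact ih (g := fun q : N × N => fderiv ℝ g q.1 q.2)
        ((L.comp (ContinuousLinearMap.fst ℝ E E)).prod (L.comp (ContinuousLinearMap.snd ℝ E E)))
        (hW.prod isOpen_univ) h1 fun p hp => ⟨hL hp.1, trivial⟩

/-- Functions which are, on `U`, the composition of a continuous linear map into a normed space
with a smooth function on an open set of that space. -/
def CylSmoothOn {E : Type u} [AddCommGroup E] [Module ℝ E] [TopologicalSpace E]
    {G : Type v} [NormedAddCommGroup G] [NormedSpace ℝ G] (f : E → G) (U : Set E) : Prop :=
  ∃ (N : Type) (_ : NormedAddCommGroup N) (_ : NormedSpace ℝ N) (L : E →L[ℝ] N) (g : N → G)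
    (W : Set N), IsOpen W ∧ MapsTo L U W ∧ ContDiffOn ℝ ∞ g W ∧ EqOn f (fun x => g (L x)) U

namespace CylSmoothOn

variable {E : Type u} [AddCommGroup E] [Module ℝ E] [TopologicalSpace E]
    {G : Type v} [NormedAddCommGroup G] [NormedSpace ℝ G]
    {G' : Type w} [NormedAddCommGroup G'] [NormedSpace ℝ G']
    {f : E → G} {f' : E → G'} {U : Set E}

theorem smoothOn [ContinuousAdd E] [ContinuousSMul ℝ E] (h : CylSmoothOn f U) (hU : IsOpen U) :
    SmoothOn f U := by
  obtain ⟨N, _, _, L, g, W, hW, hL, hg, hf⟩ := h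
  exact SmoothOn.congr hU (fun n => CkOn.of_contDiffOn L hW hg hL) hf

theorem congr {g : E → G} (h : CylSmoothOn f U) (hfg : EqOn g f U) : CylSmoothOn g U := by
  obtain ⟨N, _, _, L, k, W, hW, hL, hk, hf⟩ := h
  exact ⟨N, _, _, L, k, W, hW, hL, hk, hfg.trans hf⟩

theorem const (c : G) : CylSmoothOn (fun _ : E => c) U :=
  ⟨ℝ, _, _, 0, fun _ => c, univ, isOpen_univ, mapsTo_univ _ _, contDiff_const.contDiffOn,
    fun _ _ => rfl⟩

/-- Here `G` itself serves as the intermediate normed space, hence the universe restriction. -/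
theorem clm {G : Type} [NormedAddCommGroup G] [NormedSpace ℝ G] (L : E →L[ℝ] G) :
    CylSmoothOn (fun x => L x) U :=
  ⟨G, _, _, L, id, univ, isOpen_univ, mapsTo_univ _ _, contDiff_id.contDiffOn, fun _ _ => rfl⟩

theorem prodMk (h : CylSmoothOn f U) (h' : CylSmoothOn f' U) :
    CylSmoothOn (fun x => (f x, f' x)) U := by
  obtain ⟨N, _, _, L, g, W, hW, hL, hg, hf⟩ := h
  obtain ⟨N', _, _, L', g', W', hW', hL', hg', hf'⟩ := h'
  refine ⟨N × N', _, _, L.prod L', Prod.map g g', W ×ˢ W', hW.prod hW',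
    fun x hx => ⟨hL hx, hL' hx⟩, hg.prodMap hg', fun x hx => ?_⟩
  simp [hf hx, hf' hx]

theorem contDiffOn_comp {k : G → G'} {V : Set G} (hV : IsOpen V) (hk : ContDiffOn ℝ ∞ k V)
    (h : CylSmoothOn f U) (hU : MapsTo f U V) : CylSmoothOn (fun x => k (f x)) U := by
  obtain ⟨N, _, _, L, g, W, hW, hL, hg, hf⟩ := h
  -- The open set is shrunk so that `g` takes its values where `k` is smooth.
  refine ⟨N, _, _, L, fun y => k (g y), W ∩ g ⁻¹' V, hg.continuousOn.isOpen_inter_preimage hW hV,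
    fun x hx => ⟨hL hx, ?_⟩, hk.comp (hg.mono inter_subset_left) fun y hy => hy.2,
    fun x hx => congr_arg k (hf hx)⟩
  have h1 := hU hx
  rw [hf hx] at h1
  exact h1

theorem contDiff_comp {k : G → G'} (hk : ContDiff ℝ ∞ k) (h : CylSmoothOn f U) :
    CylSmoothOn (fun x => k (f x)) U :=
  h.contDiffOn_comp isOpen_univ hk.contDiffOn (mapsTo_univ _ _)

theorem add {g : E → G} (hf : CylSmoothOn f U) (hg : CylSmoothOn g U) :
    CylSmoothOn (fun x => f x + g x) U :=
  (hf.prodMk hg).contDiff_comp contDiff_add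

theorem sub {g : E → G} (hf : CylSmoothOn f U) (hg : CylSmoothOn g U) :
    CylSmoothOn (fun x => f x - g x) U :=
  (hf.prodMk hg).contDiff_comp (k := fun p : G × G => p.1 - p.2) (contDiff_fst.sub contDiff_snd)

theorem sum {κ : Type*} (s : Finset κ) {f : κ → E → G} (h : ∀ k ∈ s, CylSmoothOn (f k) U) :
    CylSmoothOn (fun x => ∑ k ∈ s, f k x) U := by
  classical
  induction s using Finset.induction_on with
  | empty => simpa using const (E := E) (U := U) (0 : G)
  | insert a s ha ih =>
    simp only [Finset.sum_insert ha]
    exact (h a (by simp)).add (ih fun k hk => h k (Finset.mem_insert_of_mem hk))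

variable {f g : E → ℂ}

theorem mul (hf : CylSmoothOn f U) (hg : CylSmoothOn g U) :
    CylSmoothOn (fun x => f x * g x) U :=
  (hf.prodMk hg).contDiff_comp contDiff_mul

theorem prod {κ : Type*} (s : Finset κ) {f : κ → E → ℂ} (h : ∀ k ∈ s, CylSmoothOn (f k) U) :
    CylSmoothOn (fun x => ∏ k ∈ s, f k x) U := by
  classical
  induction s using Finset.induction_on with
  | empty => simpa using const (E := E) (U := U) (1 : ℂ)
  | insert a s ha ih =>
    simp only [Finset.prod_insert ha]
    exact (h a (by simp)).mul (ih fun k hk => h k (Finset.mem_insert_of_mem hk))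

theorem inv (hf : CylSmoothOn f U) (h0 : ∀ x ∈ U, f x ≠ 0) :
    CylSmoothOn (fun x => (f x)⁻¹) U :=
  hf.contDiffOn_comp (k := fun z : ℂ => z⁻¹) (V := {0}ᶜ) isOpen_compl_singleton
    (fun _ hz => (contDiffAt_inv ℝ hz).contDiffWithinAt) h0

theorem conjugate (hf : CylSmoothOn f U) : CylSmoothOn (fun x => conj (f x)) U :=
  hf.contDiff_comp (k := fun z : ℂ => conj z) Complex.conjCLE.contDiff

theorem det {n : Type*} [Fintype n] [DecidableEq n] {A : E → Matrix n n ℂ}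
    (h : ∀ i j, CylSmoothOn (fun x => A x i j) U) : CylSmoothOn (fun x => (A x).det) U := by
  simp only [Matrix.det_apply']
  exact sum _ fun σ _ => (const _).mul (prod _ fun i _ => h _ _)

theorem matrix_mul {l n k : Type*} [Fintype n] {A : E → Matrix l n ℂ} {B : E → Matrix n k ℂ}
    (hA : ∀ i j, CylSmoothOn (fun x => A x i j) U) (hB : ∀ i j, CylSmoothOn (fun x => B x i j) U)
    (i : l) (j : k) : CylSmoothOn (fun x => (A x * B x) i j) U := by
  simp only [Matrix.mul_apply]
  exact sum _ fun _ _ => (hA _ _).mul (hB _ _)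

/-- The entries of the adjugate are determinants of `A` with one row replaced by a constant row, so
everything is polynomial apart from the division by `det A`. -/
theorem matrix_inv {n : Type*} [Fintype n] [DecidableEq n] {A : E → Matrix n n ℂ}
    (h : ∀ i j, CylSmoothOn (fun x => A x i j) U) (h0 : ∀ x ∈ U, (A x).det ≠ 0) (i j : n) :
    CylSmoothOn (fun x => (A x)⁻¹ i j) U := by
  simp only [Matrix.inv_def, Matrix.smul_apply, smul_eq_mul, Ring.inverse_eq_inv',
    Matrix.adjugate_apply]
  refine ((det h).inv h0).mul (det fun k l => ?_)
  simp only [Matrix.updateRow_apply]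
  split_ifs
  exacts [const _, h _ _]

end CylSmoothOn

end Calculus

/-! ### Retracts of products of copies of `ℂ` -/

/-- A presentation of the topological vector space `E` as a retract of `ℂ^ι`. -/
structure Coords (E : Type u) [AddCommGroup E] [Module ℝ E] [TopologicalSpace E] (ι : Type w) where
  toFun : E →L[ℝ] (ι → ℂ)
  retr : (ι → ℂ) →L[ℝ] E
  retr_toFun : ∀ x, retr (toFun x) = x

namespace Coords

variable {E : Type u} [AddCommGroup E] [Module ℝ E] [TopologicalSpace E] {ι : Type w}

theorem isClosedEmbedding [T2Space E] (c : Coords E ι) : IsClosedEmbedding c.toFun :=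
  Function.LeftInverse.isClosedEmbedding c.retr_toFun c.retr.continuous c.toFun.continuous

theorem isEmbedding (c : Coords E ι) : IsEmbedding c.toFun :=
  Topology.IsEmbedding.of_leftInverse c.retr_toFun c.retr.continuous c.toFun.continuous

theorem t2 (c : Coords E ι) : T2Space E := c.isEmbedding.t2Space

theorem isTopologicalAddGroup (c : Coords E ι) : IsTopologicalAddGroup E :=
  c.isEmbedding.toIsInducing.topologicalAddGroup c.toFun

theorem continuousSMul (c : Coords E ι) : ContinuousSMul ℝ E :=
  c.isEmbedding.toIsInducing.continuousSMul continuous_id (by simp)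

/-- A retract is closed in the Hausdorff space `ℂ^ι`, and a closed subspace inherits complete
metrizability. Countability matters here: it makes the product `ℂ^ι` metrizable. -/
theorem isFrechetSpace [Countable ι] (c : Coords E ι) : IsFrechetSpace E := by
  have := c.t2
  refine ⟨c.isTopologicalAddGroup, c.continuousSMul, ?_,
    c.isClosedEmbedding.IsCompletelyMetrizableSpace⟩
  rw [c.isEmbedding.eq_induced]
  exact LocallyConvexSpace.induced c.toFun.toLinearMap

/-- A map into a retract of `ℂ^ι` is smooth if its coordinates are. -/
theorem smoothOn (c : Coords E ι) {D : Type v} [AddCommGroup D] [Module ℝ D] [TopologicalSpace D]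
    [ContinuousAdd D] [ContinuousSMul ℝ D] {f : D → E} {U : Set D} (hU : IsOpen U)
    (h : ∀ i, CylSmoothOn (fun x => c.toFun (f x) i) U) : SmoothOn f U := fun n => by
  have h1 : CkOn n (fun x => c.toFun (f x)) U := CkOn.pi fun i => (h i).smoothOn hU n
  simpa only [c.retr_toFun] using h1.clm_comp c.retr

variable {E' : Type v} [AddCommGroup E'] [Module ℝ E'] [TopologicalSpace E'] {ι' : Type*}

/-- The coordinates on a product. -/
def prod (c : Coords E ι) (c' : Coords E' ι') : Coords (E × E') (ι ⊕ ι') where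
  toFun := ContinuousLinearMap.pi (Sum.elim
    (fun i => (ContinuousLinearMap.proj (R := ℝ) (φ := fun _ : ι => ℂ) i).comp
      (c.toFun.comp (ContinuousLinearMap.fst ℝ E E')))
    (fun i => (ContinuousLinearMap.proj (R := ℝ) (φ := fun _ : ι' => ℂ) i).comp
      (c'.toFun.comp (ContinuousLinearMap.snd ℝ E E'))))
  retr := (c.retr.comp (ContinuousLinearMap.pi fun i =>
      ContinuousLinearMap.proj (R := ℝ) (φ := fun _ : ι ⊕ ι' => ℂ) (Sum.inl i))).prod
    (c'.retr.comp (ContinuousLinearMap.pi fun i =>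
      ContinuousLinearMap.proj (R := ℝ) (φ := fun _ : ι ⊕ ι' => ℂ) (Sum.inr i)))
  retr_toFun := fun x => Prod.ext (c.retr_toFun x.1) (c'.retr_toFun x.2)

theorem cylSmoothOn (c : Coords E ι) (i : ι) (U : Set E) : CylSmoothOn (fun x => c.toFun x i) U :=
  CylSmoothOn.clm ((ContinuousLinearMap.proj (R := ℝ) (φ := fun _ : ι => ℂ) i).comp c.toFun)

end Coords

/-! ### Matrices with rows in `ℂ^Λ` and the subspaces of `c_c(Λ)` which they define -/

section LinearAlgebra

open Matrix

variable {Λ : Type u} {m : ℕ}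

/-- The linear map `c_c(Λ) → ℂ^m` whose matrix is `A`. -/
def ev (A : Matrix (Fin m) Λ ℂ) : (Λ →₀ ℂ) →ₗ[ℂ] (Fin m → ℂ) :=
  LinearMap.pi fun i => Finsupp.linearCombination ℂ (A i)

theorem ev_apply (A : Matrix (Fin m) Λ ℂ) (a : Λ →₀ ℂ) (i : Fin m) :
    ev A a i = Finsupp.linearCombination ℂ (A i) a := rfl

theorem ev_apply_sum (A : Matrix (Fin m) Λ ℂ) (a : Λ →₀ ℂ) (i : Fin m) :
    ev A a i = ∑ l ∈ a.support, a l * A i l := by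
  rw [ev_apply, Finsupp.linearCombination_apply, Finsupp.sum]
  rfl

@[simp]
theorem ev_single (A : Matrix (Fin m) Λ ℂ) (l : Λ) (i : Fin m) :
    ev A (Finsupp.single l 1) i = A i l := by
  simp [ev_apply]

theorem linearCombination_vecMul (A : Matrix (Fin m) Λ ℂ) (x : Fin m → ℂ) (a : Λ →₀ ℂ) :
    Finsupp.linearCombination ℂ (x ᵥ* A) a = x ⬝ᵥ ev A a := by
  simp only [dotProduct, ev_apply_sum, Finsupp.linearCombination_apply, Finsupp.sum, vecMul,
    smul_eq_mul, Finset.mul_sum]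
  rw [Finset.sum_comm]
  exact Finset.sum_congr rfl fun _ _ => Finset.sum_congr rfl fun _ _ => by ring

theorem ev_mul (B : Matrix (Fin m) (Fin m) ℂ) (A : Matrix (Fin m) Λ ℂ) (a : Λ →₀ ℂ) :
    ev (B * A) a = B *ᵥ ev A a :=
  funext fun i => linearCombination_vecMul A (B i) a

theorem ev_add (A B : Matrix (Fin m) Λ ℂ) (a : Λ →₀ ℂ) : ev (A + B) a = ev A a + ev B a := by
  funext i
  simp [ev_apply_sum, mul_add, Finset.sum_add_distrib]

theorem ev_sub (A B : Matrix (Fin m) Λ ℂ) (a : Λ →₀ ℂ) : ev (A - B) a = ev A a - ev B a := by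
  funext i
  simp [ev_apply_sum, mul_sub, Finset.sum_sub_distrib]

/-- The matrix of pairings of the rows of `A` with the vectors `v`. -/
def pair (A : Matrix (Fin m) Λ ℂ) (v : Fin m → Λ →₀ ℂ) : Matrix (Fin m) (Fin m) ℂ :=
  Matrix.of fun i j => ev A (v j) i

theorem pair_apply (A : Matrix (Fin m) Λ ℂ) (v : Fin m → Λ →₀ ℂ) (i j : Fin m) :
    pair A v i j = ev A (v j) i := rfl

theorem pair_mul (B : Matrix (Fin m) (Fin m) ℂ) (A : Matrix (Fin m) Λ ℂ) (v : Fin m → Λ →₀ ℂ) :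
    pair (B * A) v = B * pair A v := by
  ext i j
  rw [pair_apply, ev_mul]
  rfl

theorem pair_add (A B : Matrix (Fin m) Λ ℂ) (v : Fin m → Λ →₀ ℂ) :
    pair (A + B) v = pair A v + pair B v := by
  ext i j
  simp [pair_apply, ev_add]

theorem pair_sub (A B : Matrix (Fin m) Λ ℂ) (v : Fin m → Λ →₀ ℂ) :
    pair (A - B) v = pair A v - pair B v := by
  ext i j
  simp [pair_apply, ev_sub]

theorem ev_sum_smul (A : Matrix (Fin m) Λ ℂ) (v : Fin m → Λ →₀ ℂ) (x : Fin m → ℂ) :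
    ev A (∑ j, x j • v j) = pair A v *ᵥ x := by
  funext i
  simp [mulVec, dotProduct, pair_apply, mul_comm]

/-! ### Orthogonals, and subspaces of codimension `m` as kernels of matrices -/

theorem linearCombination_eq_zero_of_mem_perp {J : Submodule ℂ (Λ →₀ ℂ)} {ξ : Λ → ℂ}
    (hξ : ξ ∈ perp J) {a : Λ →₀ ℂ} (ha : a ∈ J) : Finsupp.linearCombination ℂ ξ a = 0 := by
  rw [Finsupp.linearCombination_apply, ← hξ a ha]
  exact Finsupp.sum_congr fun _ _ => by simp [mul_comm]

theorem mem_perp_iff {J : Submodule ℂ (Λ →₀ ℂ)} {ξ : Λ → ℂ} :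
    ξ ∈ perp J ↔ ∀ a ∈ J, Finsupp.linearCombination ℂ ξ a = 0 := by
  refine ⟨fun h a ha => linearCombination_eq_zero_of_mem_perp h ha, fun h a ha => ?_⟩
  rw [← h a ha, Finsupp.linearCombination_apply]
  exact Finsupp.sum_congr fun _ _ => by simp [mul_comm]

theorem mem_perp_span_iff {v : Fin m → Λ →₀ ℂ} {ξ : Λ → ℂ} :
    ξ ∈ perp (Submodule.span ℂ (range v)) ↔ ∀ j, Finsupp.linearCombination ℂ ξ (v j) = 0 := by
  rw [mem_perp_iff]
  change Submodule.span ℂ (range v) ≤ LinearMap.ker (Finsupp.linearCombination ℂ ξ) ↔ _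
  rw [Submodule.span_le]
  exact range_subset_iff

theorem exists_pair_eq_one {A : Matrix (Fin m) Λ ℂ} (h : Function.Surjective (ev A)) :
    ∃ v, pair A v = 1 := by
  choose v hv using fun j : Fin m => h (Pi.single j 1)
  refine ⟨v, ?_⟩
  ext i j
  rw [pair_apply, hv, Matrix.one_apply, Pi.single_apply]

theorem ev_surjective {A : Matrix (Fin m) Λ ℂ} {v : Fin m → Λ →₀ ℂ} (h : pair A v = 1) :
    Function.Surjective (ev A) := fun x => ⟨∑ j, x j • v j, by rw [ev_sum_smul, h, one_mulVec]⟩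

/-- A sequence which vanishes on the kernel of `A` is a combination of the rows of `A`. -/
theorem eq_vecMul_of_ker_le {A : Matrix (Fin m) Λ ℂ} {v : Fin m → Λ →₀ ℂ} (h : pair A v = 1)
    {ξ : Λ → ℂ} (hξ : ∀ a, ev A a = 0 → Finsupp.linearCombination ℂ ξ a = 0) :
    ξ = (fun j => Finsupp.linearCombination ℂ ξ (v j)) ᵥ* A := by
  funext l
  have h1 := hξ (Finsupp.single l 1 - ∑ j, A j l • v j) (by
    rw [map_sub, ev_sum_smul, h, one_mulVec]
    funext i
    simp)
  simp only [map_sub, map_sum, map_smul, smul_eq_mul, Finsupp.linearCombination_single, one_mul,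
    sub_eq_zero] at h1
  rw [h1]
  exact Finset.sum_congr rfl fun _ _ => mul_comm _ _

/-- Each row of `A'` vanishes on the kernel of `A`, hence is a combination of the rows of `A`;
pairing with the dual family `v` reads off the coefficients. This gives the uniqueness of normalized
matrices. -/
theorem eq_pair_mul_of_ker_le {A A' : Matrix (Fin m) Λ ℂ} {v : Fin m → Λ →₀ ℂ}
    (h : pair A v = 1) (hA : ∀ a, ev A a = 0 → ev A' a = 0) : A' = pair A' v * A := by
  ext i l
  exact congr_fun (eq_vecMul_of_ker_le h (ξ := A' i) fun a ha => congr_fun (hA a ha) i) l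

/-- The subspace `K` is the kernel of the matrix `A`. -/
def Represents (A : Matrix (Fin m) Λ ℂ) (K : Gr m Λ) : Prop :=
  LinearMap.ker (ev A) = K.1

theorem Represents.mem_iff {A : Matrix (Fin m) Λ ℂ} {K : Gr m Λ} (h : Represents A K)
    {a : Λ →₀ ℂ} : a ∈ K.1 ↔ ev A a = 0 := by
  rw [← h]
  rfl

theorem Gr.exists_represents (K : Gr m Λ) : ∃ A : Matrix (Fin m) Λ ℂ, Represents A K := by
  have := K.2.1
  let b := Module.finBasisOfFinrankEq ℂ ((Λ →₀ ℂ) ⧸ K.1) K.2.2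
  refine ⟨Matrix.of fun i l => b.coord i (K.1.mkQ (Finsupp.single l 1)), ?_⟩
  have h : ev (Matrix.of fun i l => b.coord i (K.1.mkQ (Finsupp.single l 1))) =
      b.equivFun.toLinearMap.comp K.1.mkQ := by
    ext l i
    simp
  change LinearMap.ker (ev _) = K.1
  rw [h, LinearMap.ker_comp, LinearEquiv.ker]
  exact K.1.ker_mkQ

/-- The image is isomorphic to `c_c(Λ) / K`, so it has the full dimension `m`. -/
theorem Represents.surjective {A : Matrix (Fin m) Λ ℂ} {K : Gr m Λ} (h : Represents A K) :
    Function.Surjective (ev A) := by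
  have hK : LinearMap.ker (ev A) = K.1 := h
  have e := (ev A).quotKerEquivRange
  rw [hK] at e
  rw [← LinearMap.range_eq_top]
  apply Submodule.eq_top_of_finrank_eq
  rw [← e.finrank_eq, K.2.2, Module.finrank_fin_fun]

/-- The point of the Grassmannian defined by a matrix of rank `m`. -/
def Gr.ofMatrix (A : Matrix (Fin m) Λ ℂ) (h : Function.Surjective (ev A)) : Gr m Λ :=
  ⟨LinearMap.ker (ev A), Module.Finite.equiv ((ev A).quotKerEquivOfSurjective h).symm, by
    rw [((ev A).quotKerEquivOfSurjective h).finrank_eq, Module.finrank_fin_fun]⟩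

theorem Gr.represents_ofMatrix (A : Matrix (Fin m) Λ ℂ) (h : Function.Surjective (ev A)) :
    Represents A (Gr.ofMatrix A h) := rfl

/-- The orthogonal of the kernel is the row space: no closure is needed, as the codimension is
finite. -/
theorem Represents.mem_perp_iff {A : Matrix (Fin m) Λ ℂ} {K : Gr m Λ} (h : Represents A K)
    {ξ : Λ → ℂ} : ξ ∈ perp K.1 ↔ ∃ x, ξ = x ᵥ* A := by
  constructor
  · intro hξ
    obtain ⟨v, hv⟩ := exists_pair_eq_one h.surjective
    exact ⟨_, eq_vecMul_of_ker_le hv fun a ha =>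
      linearCombination_eq_zero_of_mem_perp hξ (h.mem_iff.2 ha)⟩
  · rintro ⟨x, rfl⟩
    refine _root_.mem_perp_iff.2 fun a ha => ?_
    rw [linearCombination_vecMul, h.mem_iff.1 ha, dotProduct_zero]

theorem Represents.vecMul_injective {A : Matrix (Fin m) Λ ℂ} {K : Gr m Λ} (h : Represents A K)
    {x : Fin m → ℂ} (hx : x ᵥ* A = 0) : x = 0 := by
  obtain ⟨v, hv⟩ := exists_pair_eq_one h.surjective
  funext j
  have h1 := linearCombination_vecMul A x (v j)
  have h2 : ev A (v j) = Pi.single j 1 := by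
    funext i
    rw [← pair_apply, hv, Matrix.one_apply, Pi.single_apply]
  rw [hx, h2, dotProduct_single, mul_one] at h1
  rw [← h1]
  simp

/-- A combination `x A` of the independent rows of `A` is orthogonal to `v` exactly when `x` is in
the left kernel of `pair A v`. -/
theorem Represents.mem_chartDomain_iff {A : Matrix (Fin m) Λ ℂ} {K : Gr m Λ} (h : Represents A K)
    {v : Fin m → Λ →₀ ℂ} :
    K ∈ chartDomain (Submodule.span ℂ (range v)) ↔ (pair A v).det ≠ 0 := by
  have key : ∀ x : Fin m → ℂ,
      x ᵥ* A ∈ perp (Submodule.span ℂ (range v)) ↔ x ᵥ* pair A v = 0 := by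
    intro x
    rw [mem_perp_span_iff, funext_iff]
    refine forall_congr' fun j => ?_
    rw [linearCombination_vecMul]
    rfl
  rw [Ne, ← Matrix.exists_vecMul_eq_zero_iff]
  constructor
  · rintro hK ⟨x, hx0, hx⟩
    have h1 : x ᵥ* A ∈ perp K.1 ⊓ perp (Submodule.span ℂ (range v)) :=
      ⟨h.mem_perp_iff.2 ⟨x, rfl⟩, (key x).2 hx⟩
    rw [show perp K.1 ⊓ perp (Submodule.span ℂ (range v)) = ⊥ from hK, Submodule.mem_bot] at h1
    exact hx0 (h.vecMul_injective h1)
  · intro hn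
    refine (Submodule.eq_bot_iff _).2 ?_
    rintro ξ ⟨h1, h2⟩
    obtain ⟨x, rfl⟩ := h.mem_perp_iff.1 h1
    have h3 : x = 0 := by
      by_contra hx
      exact hn ⟨x, hx, (key x).1 h2⟩
    rw [h3, zero_vecMul]

theorem Represents.mul {A : Matrix (Fin m) Λ ℂ} {K : Gr m Λ} (h : Represents A K)
    {B : Matrix (Fin m) (Fin m) ℂ} (hB : B.det ≠ 0) : Represents (B * A) K := by
  refine Submodule.ext fun a => ?_
  rw [h.mem_iff, LinearMap.mem_ker, ev_mul]
  refine ⟨fun h1 => ?_, fun h1 => by rw [h1, mulVec_zero]⟩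
  by_contra h2
  exact hB (Matrix.exists_mulVec_eq_zero_iff.1 ⟨_, h2, h1⟩)

/-- A matrix which represents the subspace `K` and is dual to the family `v`, provided that `K` is
a supplement of its span. -/
def Gr.frameMat (K : Gr m Λ) (v : Fin m → Λ →₀ ℂ) : Matrix (Fin m) Λ ℂ :=
  open Classical in
  -- Outside `U_v` an arbitrary matrix of `K` is kept, so that the result represents `K` in all
  -- cases; only the duality with `v` is then lost.
  if (pair K.exists_represents.choose v).det = 0 then K.exists_represents.choose
  else (pair K.exists_represents.choose v)⁻¹ * K.exists_represents.choose

theorem Matrix.det_nonsing_inv_ne_zero {n : Type*} [Fintype n] [DecidableEq n] {B : Matrix n n ℂ}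
    (h : B.det ≠ 0) : B⁻¹.det ≠ 0 := by
  rw [Matrix.det_nonsing_inv, Ring.inverse_eq_inv']
  exact inv_ne_zero h

theorem Gr.represents_frameMat (K : Gr m Λ) (v : Fin m → Λ →₀ ℂ) :
    Represents (K.frameMat v) K := by
  unfold Gr.frameMat
  split_ifs with h
  · exact K.exists_represents.choose_spec
  · exact K.exists_represents.choose_spec.mul (Matrix.det_nonsing_inv_ne_zero h)

theorem Gr.pair_frameMat {K : Gr m Λ} {v : Fin m → Λ →₀ ℂ}
    (h : K ∈ chartDomain (Submodule.span ℂ (range v))) : pair (K.frameMat v) v = 1 := by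
  have h1 := (K.exists_represents.choose_spec.mem_chartDomain_iff).1 h
  rw [Gr.frameMat, if_neg h1, pair_mul, Matrix.nonsing_inv_mul _ (isUnit_iff_ne_zero.2 h1)]

theorem Represents.mem_chartDomain {A : Matrix (Fin m) Λ ℂ} {K : Gr m Λ} (hA : Represents A K)
    {v : Fin m → Λ →₀ ℂ} (h1 : pair A v = 1) : K ∈ chartDomain (Submodule.span ℂ (range v)) := by
  rw [hA.mem_chartDomain_iff, h1, det_one]
  exact one_ne_zero

theorem Represents.frameMat_eq_self {A : Matrix (Fin m) Λ ℂ} {K : Gr m Λ} (hA : Represents A K)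
    {v : Fin m → Λ →₀ ℂ} (h1 : pair A v = 1) : K.frameMat v = A := by
  have h2 := eq_pair_mul_of_ker_le h1 fun a ha =>
    (K.represents_frameMat v).mem_iff.1 (hA.mem_iff.2 ha)
  rw [h2, K.pair_frameMat (hA.mem_chartDomain h1), Matrix.one_mul]

theorem Represents.frameMat_eq {A : Matrix (Fin m) Λ ℂ} {K : Gr m Λ} (hA : Represents A K)
    {v : Fin m → Λ →₀ ℂ} (h : K ∈ chartDomain (Submodule.span ℂ (range v))) :
    K.frameMat v = (pair A v)⁻¹ * A := by
  have h1 := hA.mem_chartDomain_iff.1 h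
  refine (hA.mul (Matrix.det_nonsing_inv_ne_zero h1)).frameMat_eq_self ?_
  rw [pair_mul, Matrix.nonsing_inv_mul _ (isUnit_iff_ne_zero.2 h1)]

/-- A family dual to the rows of any matrix of `K` works: `a ↦ ∑ (ev A a)_j v_j` is then the
projection onto its span along `K`. -/
theorem Gr.exists_mem_chartDomain (K : Gr m Λ) : ∃ v : Fin m → Λ →₀ ℂ,
    LinearIndependent ℂ v ∧ K ∈ chartDomain (Submodule.span ℂ (range v)) ∧
      IsCompl K.1 (Submodule.span ℂ (range v)) := by
  obtain ⟨A, hA⟩ := K.exists_represents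
  obtain ⟨v, hv⟩ := exists_pair_eq_one hA.surjective
  have key : ∀ x : Fin m → ℂ, ev A (∑ j, x j • v j) = x := fun x => by
    rw [ev_sum_smul, hv, one_mulVec]
  refine ⟨v, ?_, hA.mem_chartDomain hv, ?_, ?_⟩
  · rw [Fintype.linearIndependent_iff]
    intro x hx i
    have h := key x
    rw [hx, map_zero] at h
    rw [← h]
    rfl
  · rw [Submodule.disjoint_def]
    intro a ha hav
    obtain ⟨x, rfl⟩ := (Submodule.mem_span_range_iff_exists_fun ℂ).1 hav
    rw [hA.mem_iff, key] at ha
    simp [ha]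
  · rw [codisjoint_iff, eq_top_iff]
    intro a _
    rw [← sub_add_cancel a (∑ j, ev A a j • v j)]
    refine Submodule.add_mem_sup (hA.mem_iff.2 ?_)
      ((Submodule.mem_span_range_iff_exists_fun ℂ).2 ⟨_, rfl⟩)
    rw [map_sub, key, sub_self]

/-- A basis of the supplement which belongs to a chart. -/
theorem ChartIdx.exists_frame (p : ChartIdx m Λ) :
    ∃ w : Fin m → Λ →₀ ℂ, Submodule.span ℂ (range w) = p.J' := by
  have := p.J.2.1
  let e := Submodule.quotientEquivOfIsCompl p.J.1 p.J' p.isCompl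
  let b := (Module.finBasisOfFinrankEq ℂ ((Λ →₀ ℂ) ⧸ p.J.1) p.J.2.2).map e
  refine ⟨fun i => b i, ?_⟩
  have h : range (fun i => (b i : Λ →₀ ℂ)) = p.J'.subtype '' range b := by
    rw [← range_comp]
    rfl
  rw [h, Submodule.span_image, b.span_eq, Submodule.map_top, Submodule.range_subtype]

def ChartIdx.frame (p : ChartIdx m Λ) : Fin m → Λ →₀ ℂ := p.exists_frame.choose

theorem ChartIdx.span_frame (p : ChartIdx m Λ) : Submodule.span ℂ (range p.frame) = p.J' :=
  p.exists_frame.choose_spec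

/-- A sequence orthogonal to both `J` and `J'` is orthogonal to their sum, which is everything. -/
theorem ChartIdx.mem_chartDomain (p : ChartIdx m Λ) :
    p.J ∈ chartDomain (Submodule.span ℂ (range p.frame)) := by
  rw [p.span_frame]
  refine (Submodule.eq_bot_iff _).2 ?_
  rintro ξ ⟨h1, h2⟩
  have h3 : (⊤ : Submodule ℂ (Λ →₀ ℂ)) ≤ LinearMap.ker (Finsupp.linearCombination ℂ ξ) := by
    rw [← p.isCompl.sup_eq_top]
    exact sup_le (fun a ha => linearCombination_eq_zero_of_mem_perp h1 ha)
      fun a ha => linearCombination_eq_zero_of_mem_perp h2 ha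
  funext l
  simpa using h3 (Submodule.mem_top (x := Finsupp.single l 1))

end LinearAlgebra

/-! ### The topology of the Grassmannian -/

section GrassmannTopology

open Matrix

variable {Λ : Type u} {m : ℕ}

theorem grassmannCoord_mul (B : Matrix (Fin m) (Fin m) ℂ) (A : Matrix (Fin m) Λ ℂ) :
    grassmannCoord (B * A) = B.det • grassmannCoord A := by
  funext f
  change Matrix.det _ = B.det * Matrix.det _
  rw [← det_mul]
  rfl

/-- The Grassmann embedding in terms of a matrix. -/
theorem Represents.plucker_eq {A : Matrix (Fin m) Λ ℂ} {K : Gr m Λ} (h : Represents A K) :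
    ∃ h0 : grassmannCoord A ≠ 0, K.plucker = Projectivization.mk ℂ (grassmannCoord A) h0 := by
  obtain ⟨hli, hspan, h0⟩ := K.exists_basis.choose_spec
  have hmem : ∀ i, ∃ x, K.exists_basis.choose i = x ᵥ* A := fun i =>
    h.mem_perp_iff.1 (hspan.le (Submodule.subset_span ⟨i, rfl⟩))
  choose B hB using hmem
  have hBA : K.exists_basis.choose = (Matrix.of B * A : Matrix (Fin m) Λ ℂ) :=
    funext fun i => hB i
  have hg : grassmannCoord K.exists_basis.choose = (Matrix.of B).det • grassmannCoord A := by
    rw [hBA, grassmannCoord_mul]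
  have hdet : (Matrix.of B).det ≠ 0 := fun hd => h0 (by rw [hg, hd, zero_smul])
  have hA0 : grassmannCoord A ≠ 0 := fun hA => h0 (by rw [hg, hA, smul_zero])
  refine ⟨hA0, ?_⟩
  rw [Gr.plucker, Projectivization.mk_eq_mk_iff]
  exact ⟨Units.mk0 _ hdet, hg.symm⟩

/-- The pairing of Grassmann coordinates with `v_1 ∧ ⋯ ∧ v_m`. -/
def wedgePair (v : Fin m → Λ →₀ ℂ) : ((Fin m → Λ) → ℂ) →ₗ[ℂ] ℂ :=
  ∑ f ∈ Fintype.piFinset fun j => (v j).support, (∏ j, v j (f j)) • LinearMap.proj f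

theorem wedgePair_apply (v : Fin m → Λ →₀ ℂ) (P : (Fin m → Λ) → ℂ) :
    wedgePair v P = ∑ f ∈ Fintype.piFinset fun j => (v j).support, (∏ j, v j (f j)) * P f := by
  simp [wedgePair]

theorem continuous_wedgePair (v : Fin m → Λ →₀ ℂ) : Continuous (wedgePair v) := by
  simp only [funext (wedgePair_apply v)]
  fun_prop

/-- The columns of `pair A v` are finite combinations of columns of `A`; expanding the determinant
multilinearly produces the minors of `A`. -/
theorem wedgePair_grassmannCoord (v : Fin m → Λ →₀ ℂ) (A : Matrix (Fin m) Λ ℂ) :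
    wedgePair v (grassmannCoord A) = (pair A v).det := by
  classical
  have h1 : (pair A v)ᵀ = fun j => ∑ l ∈ (v j).support, v j l • fun i => A i l := by
    ext j i
    simp [pair_apply, ev_apply_sum]
  rw [← det_transpose, h1, wedgePair_apply]
  have h2 := (Matrix.detRowAlternating (n := Fin m) (R := ℂ)).toMultilinearMap.map_sum_finset
    (fun (j : Fin m) (l : Λ) => v j l • fun i => A i l) (fun j => (v j).support)
  refine Eq.trans ?_ h2.symm
  refine Finset.sum_congr rfl fun f _ => ?_
  rw [MultilinearMap.map_smul_univ, smul_eq_mul]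
  exact congr_arg _ (det_transpose _).symm

/-! ### Homogeneous functions on the projective space -/

theorem isQuotientMap_projectivization (V : Type u) [AddCommGroup V] [Module ℂ V]
    [TopologicalSpace V] : IsQuotientMap (Projectivization.mk' ℂ : { x : V // x ≠ 0 } → _) :=
  ⟨⟨rfl⟩, fun x => ⟨⟨x.rep, x.rep_nonzero⟩, x.mk_rep⟩⟩

/-- A chosen representative is known only up to a scalar, but the scalar is the same for all `v`.
Hence vanishing, quotients and comparisons of norms of the values of `wedgePair` are intrinsic. -/
theorem wedgePair_rep_mk (P : (Fin m → Λ) → ℂ) (hP : P ≠ 0) : ∃ c : ℂ, c ≠ 0 ∧ ∀ v,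
    wedgePair v (Projectivization.mk ℂ P hP).rep = c * wedgePair v P := by
  obtain ⟨c, hc⟩ := Projectivization.exists_smul_eq_mk_rep ℂ P hP
  refine ⟨c, c.ne_zero, fun v => ?_⟩
  rw [← hc, Units.smul_def, map_smul, smul_eq_mul]

theorem Represents.wedgePair_plucker_rep {A : Matrix (Fin m) Λ ℂ} {K : Gr m Λ}
    (h : Represents A K) : ∃ c : ℂ, c ≠ 0 ∧ ∀ v,
      wedgePair v K.plucker.rep = c * (pair A v).det := by
  obtain ⟨h0, hK⟩ := h.plucker_eq
  obtain ⟨c, hc, h1⟩ := wedgePair_rep_mk _ h0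
  exact ⟨c, hc, fun v => by rw [hK, h1, wedgePair_grassmannCoord]⟩

theorem Gr.continuous_plucker : Continuous (Gr.plucker : Gr m Λ → _) := continuous_induced_dom

theorem Gr.mem_chartDomain_iff_wedgePair {K : Gr m Λ} {v : Fin m → Λ →₀ ℂ} :
    K ∈ chartDomain (Submodule.span ℂ (range v)) ↔ wedgePair v K.plucker.rep ≠ 0 := by
  obtain ⟨A, hA⟩ := K.exists_represents
  obtain ⟨c, hc, h⟩ := hA.wedgePair_plucker_rep
  rw [hA.mem_chartDomain_iff, h]
  simp [hc]

theorem isOpen_setOf_wedgePair_rep_ne_zero (v : Fin m → Λ →₀ ℂ) :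
    IsOpen {x : Projectivization ℂ ((Fin m → Λ) → ℂ) | wedgePair v x.rep ≠ 0} := by
  rw [← (isQuotientMap_projectivization _).isOpen_preimage]
  have h : Projectivization.mk' ℂ ⁻¹' {x : Projectivization ℂ ((Fin m → Λ) → ℂ) |
      wedgePair v x.rep ≠ 0} = {P | wedgePair v P.1 ≠ 0} := by
    ext P
    obtain ⟨c, hc, h⟩ := wedgePair_rep_mk P.1 P.2
    change wedgePair v (Projectivization.mk ℂ P.1 P.2).rep ≠ 0 ↔ _
    rw [h]
    simp [hc]
  rw [h]
  exact isOpen_ne_fun ((continuous_wedgePair v).comp continuous_subtype_val) continuous_const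

theorem isOpen_chartDomain_span (v : Fin m → Λ →₀ ℂ) :
    IsOpen (chartDomain (Submodule.span ℂ (range v)) : Set (Gr m Λ)) := by
  have h : (chartDomain (Submodule.span ℂ (range v)) : Set (Gr m Λ)) =
      Gr.plucker ⁻¹' {x | wedgePair v x.rep ≠ 0} :=
    ext fun K => Gr.mem_chartDomain_iff_wedgePair
  rw [h]
  exact (isOpen_setOf_wedgePair_rep_ne_zero v).preimage Gr.continuous_plucker

/-- The quotient is homogeneous of degree zero, so it descends from nonzero vectors to the
projective space, and continuity can be checked upstairs. -/
theorem continuousOn_wedgePair_div (u v : Fin m → Λ →₀ ℂ) :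
    ContinuousOn (fun x : Projectivization ℂ ((Fin m → Λ) → ℂ) =>
      wedgePair u x.rep / wedgePair v x.rep) {x | wedgePair v x.rep ≠ 0} := by
  rw [(isQuotientMap_projectivization _).continuousOn_isOpen_iff
    (isOpen_setOf_wedgePair_rep_ne_zero v)]
  have h : ContinuousOn (fun P : { P : (Fin m → Λ) → ℂ // P ≠ 0 } =>
      wedgePair u P.1 / wedgePair v P.1) {P | wedgePair v P.1 ≠ 0} :=
    ContinuousOn.div ((continuous_wedgePair u).comp continuous_subtype_val).continuousOn
      ((continuous_wedgePair v).comp continuous_subtype_val).continuousOn fun P hP => hP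
  refine (h.mono fun P hP => ?_).congr fun P hP => ?_
  · obtain ⟨c, hc, h⟩ := wedgePair_rep_mk P.1 P.2
    have h1 : wedgePair v (Projectivization.mk ℂ P.1 P.2).rep ≠ 0 := hP
    rw [h] at h1
    exact right_ne_zero_of_mul h1
  · obtain ⟨c, hc, h⟩ := wedgePair_rep_mk P.1 P.2
    change wedgePair u (Projectivization.mk ℂ P.1 P.2).rep /
      wedgePair v (Projectivization.mk ℂ P.1 P.2).rep = _
    rw [h, h, mul_div_mul_left _ _ hc]

/-- Cramer's rule: replacing `v_i` by `δ_l` replaces the `i`-th column of `pair A v` by the `l`-th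
column of `A`. -/
theorem inv_pair_mul_apply {A : Matrix (Fin m) Λ ℂ} {v : Fin m → Λ →₀ ℂ} (i : Fin m) (l : Λ) :
    ((pair A v)⁻¹ * A) i l =
      (pair A (Function.update v i (Finsupp.single l 1))).det / (pair A v).det := by
  have h1 : pair A (Function.update v i (Finsupp.single l 1)) =
      (pair A v).updateCol i fun k => A k l := by
    ext k j
    rw [pair_apply, Matrix.updateCol_apply]
    by_cases hj : j = i
    · subst hj
      simp
    · simp [hj, pair_apply]
  rw [h1, ← Matrix.cramer_apply, Matrix.cramer_eq_adjugate_mulVec, Matrix.inv_def,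
    Ring.inverse_eq_inv', Matrix.smul_mul, Matrix.smul_apply, smul_eq_mul, div_eq_inv_mul]
  rfl

/-- The coefficients of the frame of `K^⊥` dual to `v` depend continuously on `K`. -/
theorem Gr.continuousOn_frameMat (v : Fin m → Λ →₀ ℂ) (i : Fin m) (l : Λ) :
    ContinuousOn (fun K : Gr m Λ => K.frameMat v i l)
      (chartDomain (Submodule.span ℂ (range v))) := by
  have h1 := (continuousOn_wedgePair_div (Function.update v i (Finsupp.single l 1)) v).comp
    (Gr.continuous_plucker (m := m) (Λ := Λ)).continuousOn
    (s := chartDomain (Submodule.span ℂ (range v)))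
    fun K hK => Gr.mem_chartDomain_iff_wedgePair.1 hK
  refine h1.congr fun K hK => ?_
  obtain ⟨A, hA⟩ := K.exists_represents
  obtain ⟨c, hc, h⟩ := hA.wedgePair_plucker_rep
  rw [hA.frameMat_eq hK, inv_pair_mul_apply, Function.comp_apply, h, h, mul_div_mul_left _ _ hc]

/-- A map to the Grassmannian is continuous if it is represented by continuous matrices. -/
theorem Gr.continuousOn_of_represents {X : Type*} [TopologicalSpace X] {κ : X → Gr m Λ}
    {A : X → Matrix (Fin m) Λ ℂ} {s : Set X} (hA : ∀ i l, ContinuousOn (fun x => A x i l) s)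
    (h : ∀ x ∈ s, Represents (A x) (κ x)) : ContinuousOn κ s := by
  rw [continuousOn_iff_continuous_domRestrict]
  refine continuous_induced_rng.2 ?_
  have h1 : Continuous fun x : s => grassmannCoord (A x) := by
    refine continuous_pi fun f => Continuous.matrix_det ?_
    refine continuous_matrix fun i j => ?_
    exact continuousOn_iff_continuous_domRestrict.1 (hA i (f j))
  have h2 : Gr.plucker ∘ s.domRestrict κ = Projectivization.mk' ℂ ∘
      fun x : s => ⟨grassmannCoord (A x), (h x x.2).plucker_eq.choose⟩ :=
    funext fun x => (h x x.2).plucker_eq.choose_spec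
  rw [h2]
  exact (isQuotientMap_projectivization _).continuous.comp (h1.subtype_mk _)

theorem Gr.eq_of_frameMat_eq {K K' : Gr m Λ} {v : Fin m → Λ →₀ ℂ}
    (h : K.frameMat v = K'.frameMat v) : K = K' := by
  apply Subtype.ext
  ext a
  rw [(K.represents_frameMat v).mem_iff, (K'.represents_frameMat v).mem_iff, h]

/-- These sets separate two points which have no chart domain in common. -/
theorem isOpen_setOf_norm_wedgePair_rep_lt (u v : Fin m → Λ →₀ ℂ) :
    IsOpen {x : Projectivization ℂ ((Fin m → Λ) → ℂ) |
      ‖wedgePair u x.rep‖ < ‖wedgePair v x.rep‖} := by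
  rw [← (isQuotientMap_projectivization _).isOpen_preimage]
  have h : Projectivization.mk' ℂ ⁻¹' {x : Projectivization ℂ ((Fin m → Λ) → ℂ) |
      ‖wedgePair u x.rep‖ < ‖wedgePair v x.rep‖} =
      {P | ‖wedgePair u P.1‖ < ‖wedgePair v P.1‖} := by
    ext P
    obtain ⟨c, hc, h⟩ := wedgePair_rep_mk P.1 P.2
    change ‖wedgePair u (Projectivization.mk ℂ P.1 P.2).rep‖ <
      ‖wedgePair v (Projectivization.mk ℂ P.1 P.2).rep‖ ↔ _
    rw [h, h, norm_mul, norm_mul]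
    exact mul_lt_mul_iff_right₀ (norm_pos_iff.2 hc)
  rw [h]
  exact isOpen_lt ((continuous_wedgePair u).comp continuous_subtype_val).norm
    ((continuous_wedgePair v).comp continuous_subtype_val).norm

instance Gr.t2Space : T2Space (Gr m Λ) := by
  refine ⟨fun K K' hne => ?_⟩
  -- In a common domain `U_v`, some entry of the normalized matrices is a continuous function which
  -- separates the points.
  have common : ∀ v : Fin m → Λ →₀ ℂ, K ∈ chartDomain (Submodule.span ℂ (range v)) →
      K' ∈ chartDomain (Submodule.span ℂ (range v)) →
      ∃ s t : Set (Gr m Λ), IsOpen s ∧ IsOpen t ∧ K ∈ s ∧ K' ∈ t ∧ Disjoint s t := by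
    intro v hK hK'
    obtain ⟨i, l, hil⟩ : ∃ i l, K.frameMat v i l ≠ K'.frameMat v i l := by
      by_contra! hall
      exact hne (Gr.eq_of_frameMat_eq (Matrix.ext hall))
    obtain ⟨s, t, hs, ht, hKs, hKt, hst⟩ := t2_separation hil
    have hc := Gr.continuousOn_frameMat (Λ := Λ) v i l
    exact ⟨_, _, hc.isOpen_inter_preimage (isOpen_chartDomain_span v) hs,
      hc.isOpen_inter_preimage (isOpen_chartDomain_span v) ht, ⟨hK, hKs⟩, ⟨hK', hKt⟩,
      (hst.preimage _).mono inter_subset_right inter_subset_right⟩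
  obtain ⟨v, -, hKv, -⟩ := K.exists_mem_chartDomain
  obtain ⟨v', -, hKv', -⟩ := K'.exists_mem_chartDomain
  by_cases h1 : K' ∈ chartDomain (Submodule.span ℂ (range v))
  · exact common v hKv h1
  by_cases h2 : K ∈ chartDomain (Submodule.span ℂ (range v'))
  · exact common v' h2 hKv'
  rw [Gr.mem_chartDomain_iff_wedgePair] at hKv hKv' h1 h2
  rw [not_not] at h1 h2
  -- Otherwise the coordinate along `v` vanishes at `K'` but not at `K`, and the one along `v'`
  -- vanishes at `K` but not at `K'`. Comparing their norms gives disjoint neighborhoods.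
  refine ⟨_, _, (isOpen_setOf_norm_wedgePair_rep_lt v' v).preimage Gr.continuous_plucker,
    (isOpen_setOf_norm_wedgePair_rep_lt v v').preimage Gr.continuous_plucker, ?_, ?_, ?_⟩
  · simpa [h2] using hKv
  · simpa [h1] using hKv'
  · rw [Set.disjoint_left]
    intro x hx hx'
    exact lt_asymm (show ‖wedgePair v' x.plucker.rep‖ < ‖wedgePair v x.plucker.rep‖ from hx) hx'

end GrassmannTopology

/-! ### The charts of the Grassmannian -/

section Charts

open Matrix

variable {Λ : Type u} {m : ℕ}

/-- The basis of `H = J^⊥` dual to the chosen basis of the supplement `J'`. -/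
def ChartIdx.base (p : ChartIdx m Λ) : Matrix (Fin m) Λ ℂ := p.J.frameMat p.frame

theorem ChartIdx.represents_base (p : ChartIdx m Λ) : Represents p.base p.J :=
  p.J.represents_frameMat _

theorem ChartIdx.pair_base (p : ChartIdx m Λ) : pair p.base p.frame = 1 :=
  Gr.pair_frameMat p.mem_chartDomain

theorem ChartIdx.base_mem (p : ChartIdx m Λ) (i : Fin m) : p.base i ∈ perp p.J.1 :=
  p.represents_base.mem_perp_iff.2 ⟨Pi.single i 1, by rw [single_one_vecMul]; rfl⟩

theorem ChartIdx.mem_perp_iff (p : ChartIdx m Λ) {ξ : Λ → ℂ} :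
    ξ ∈ perp p.J' ↔ ∀ j, Finsupp.linearCombination ℂ ξ (p.frame j) = 0 := by
  rw [← p.span_frame, mem_perp_span_iff]

/-- The coordinates of an element of `J^⊥` in the basis `p.base`. -/
def ChartIdx.coeff (p : ChartIdx m Λ) (ξ : Λ → ℂ) : Fin m → ℂ :=
  fun j => Finsupp.linearCombination ℂ ξ (p.frame j)

theorem ChartIdx.coeff_vecMul (p : ChartIdx m Λ) (x : Fin m → ℂ) (A : Matrix (Fin m) Λ ℂ) :
    p.coeff (x ᵥ* A) = x ᵥ* pair A p.frame :=
  funext fun j => linearCombination_vecMul A x (p.frame j)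

theorem ChartIdx.coeff_apply (p : ChartIdx m Λ) (ξ : Λ → ℂ) (j : Fin m) :
    p.coeff ξ j = ∑ l ∈ (p.frame j).support, p.frame j l * ξ l := by
  rw [ChartIdx.coeff, Finsupp.linearCombination_apply, Finsupp.sum]
  rfl

theorem ChartIdx.eq_coeff_vecMul_base (p : ChartIdx m Λ) {ξ : Λ → ℂ} (hξ : ξ ∈ perp p.J.1) :
    ξ = p.coeff ξ ᵥ* p.base :=
  eq_vecMul_of_ker_le p.pair_base fun _ ha =>
    linearCombination_eq_zero_of_mem_perp hξ (p.represents_base.mem_iff.2 ha)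

theorem ChartIdx.coeff_base (p : ChartIdx m Λ) (i : Fin m) : p.coeff (p.base i) = Pi.single i 1 := by
  have h : p.base i = Pi.single i 1 ᵥ* p.base := by rw [single_one_vecMul]; rfl
  rw [h, p.coeff_vecMul, p.pair_base, vecMul_one]

/-- The projection of a matrix onto the matrices whose rows belong to `J'^⊥`. -/
def ChartIdx.project (p : ChartIdx m Λ) (D : Matrix (Fin m) Λ ℂ) : Matrix (Fin m) Λ ℂ :=
  D - pair D p.frame * p.base

theorem ChartIdx.pair_project (p : ChartIdx m Λ) (D : Matrix (Fin m) Λ ℂ) :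
    pair (p.project D) p.frame = 0 := by
  rw [ChartIdx.project, pair_sub, pair_mul, p.pair_base, Matrix.mul_one, sub_self]

theorem ChartIdx.project_of_pair_eq_zero (p : ChartIdx m Λ) {D : Matrix (Fin m) Λ ℂ}
    (h : pair D p.frame = 0) : p.project D = D := by
  rw [ChartIdx.project, h, Matrix.zero_mul, sub_zero]

theorem pair_smul (c : ℂ) (A : Matrix (Fin m) Λ ℂ) (v : Fin m → Λ →₀ ℂ) :
    pair (c • A) v = c • pair A v := by
  ext i j
  simp only [pair_apply, ev_apply_sum, Matrix.smul_apply, smul_eq_mul, Finset.mul_sum]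
  exact Finset.sum_congr rfl fun _ _ => by ring

theorem continuous_pair_apply (v : Fin m → Λ →₀ ℂ) (i j : Fin m) :
    Continuous fun A : Matrix (Fin m) Λ ℂ => pair A v i j := by
  simp only [pair_apply, ev_apply_sum]
  exact continuous_finsetSum _ fun l _ => continuous_const.mul (continuous_id.matrix_elem i l)

theorem ChartIdx.continuous_project (p : ChartIdx m Λ) : Continuous p.project := by
  refine continuous_matrix fun i l => ?_
  simp only [ChartIdx.project, Matrix.sub_apply, Matrix.mul_apply]
  refine (continuous_id.matrix_elem i l).sub (continuous_finsetSum _ fun j _ => ?_)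
  exact (continuous_pair_apply _ _ _).mul continuous_const

theorem ChartIdx.vecMul_project_mem (p : ChartIdx m Λ) (x : Fin m → ℂ) (D : Matrix (Fin m) Λ ℂ) :
    x ᵥ* p.project D ∈ perp p.J' := by
  refine p.mem_perp_iff.2 fun j => ?_
  have h := congr_fun (p.coeff_vecMul x (p.project D)) j
  rwa [p.pair_project, vecMul_zero] at h

theorem ChartIdx.continuous_coeff (p : ChartIdx m Λ) : Continuous p.coeff := by
  refine continuous_pi fun j => ?_
  simp only [p.coeff_apply]
  fun_prop

/-- The linear map `H → H'` defined by a matrix. -/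
def ChartIdx.clmOfMatrix (p : ChartIdx m Λ) (D : Matrix (Fin m) Λ ℂ) :
    perp p.J.1 →L[ℂ] perp p.J' where
  toFun ξ := ⟨p.coeff ξ ᵥ* p.project D, p.vecMul_project_mem _ _⟩
  map_add' ξ η := Subtype.ext <| by
    have h : p.coeff ((ξ + η : perp p.J.1) : Λ → ℂ) = p.coeff ξ + p.coeff η := by
      funext j
      simp [p.coeff_apply, mul_add, Finset.sum_add_distrib]
    simp only [h, add_vecMul]
    rfl
  map_smul' c ξ := Subtype.ext <| by
    have h : p.coeff ((c • ξ : perp p.J.1) : Λ → ℂ) = c • p.coeff ξ := by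
      funext j
      simp only [p.coeff_apply, Submodule.coe_smul, Pi.smul_apply, smul_eq_mul, Finset.mul_sum]
      exact Finset.sum_congr rfl fun _ _ => by ring
    simp only [h, smul_vecMul]
    rfl
  cont := by
    refine Continuous.subtype_mk ?_ _
    exact (p.continuous_coeff.comp continuous_subtype_val).matrix_vecMul continuous_const

/-- The linear dependence of `clmOfMatrix` on the matrix. -/
def ChartIdx.retrLinear (p : ChartIdx m Λ) :
    (Fin m × Λ → ℂ) →ₗ[ℂ] (perp p.J.1 →L[ℂ] perp p.J') where
  toFun D := p.clmOfMatrix (Matrix.of (Function.curry D))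
  map_add' D D' := by
    have h : p.project (Matrix.of (Function.curry (D + D'))) =
        p.project (Matrix.of (Function.curry D)) + p.project (Matrix.of (Function.curry D')) := by
      have h1 : Matrix.of (Function.curry (D + D')) =
        Matrix.of (Function.curry D) + Matrix.of (Function.curry D') := rfl
      rw [h1, ChartIdx.project, pair_add, Matrix.add_mul, add_sub_add_comm]
      rfl
    ext ξ : 2
    simp only [ChartIdx.clmOfMatrix, h, vecMul_add]
    rfl
  map_smul' c D := by
    have h : p.project (Matrix.of (Function.curry (c • D))) =
        c • p.project (Matrix.of (Function.curry D)) := by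
      have h1 : Matrix.of (Function.curry (c • D)) = c • Matrix.of (Function.curry D) := rfl
      rw [h1, ChartIdx.project, pair_smul, Matrix.smul_mul, ← smul_sub]
      rfl
    ext ξ : 2
    simp only [ChartIdx.clmOfMatrix, h, vecMul_smul]
    rfl

theorem ChartIdx.continuous_retrLinear (p : ChartIdx m Λ) : Continuous p.retrLinear := by
  -- As the family of operators depends linearly on `D`, joint continuity in `(D, ξ)` suffices for
  -- continuity into the space of operators.
  refine ContinuousLinearMap.continuous_of_continuous_uncurry _ ?_
  refine Continuous.subtype_mk ?_ _
  refine Continuous.matrix_vecMul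
    (p.continuous_coeff.comp (continuous_subtype_val.comp continuous_snd)) ?_
  refine p.continuous_project.comp ?_
  exact continuous_matrix fun i l => (continuous_apply (i, l)).comp continuous_fst

/-- The rows of the matrix of an element of the model space. -/
def ChartIdx.Model.mat {p : ChartIdx m Λ} (T : p.Model) : Matrix (Fin m) Λ ℂ :=
  Matrix.of fun i l => (T.toCLM ⟨p.base i, p.base_mem i⟩ : Λ → ℂ) l

/-- The element of the model space with a given matrix. -/
def ChartIdx.ofMat (p : ChartIdx m Λ) (D : Matrix (Fin m) Λ ℂ) : p.Model := p.clmOfMatrix D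

theorem ChartIdx.toCLM_ofMat (p : ChartIdx m Λ) (D : Matrix (Fin m) Λ ℂ) (ξ : perp p.J.1) :
    ((p.ofMat D).toCLM ξ : Λ → ℂ) = p.coeff ξ ᵥ* p.project D := rfl

theorem ChartIdx.Model.pair_mat {p : ChartIdx m Λ} (T : p.Model) : pair T.mat p.frame = 0 := by
  ext i j
  exact (p.mem_perp_iff.1 (T.toCLM ⟨p.base i, p.base_mem i⟩).2) j

/-- The map `T` is determined by its values on the basis `p.base`, and these already lie in `J'^⊥`,
where `p.project` does nothing. -/
theorem ChartIdx.ofMat_mat (p : ChartIdx m Λ) (T : p.Model) : p.ofMat T.mat = T := by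
  refine ContinuousLinearMap.ext fun ξ => Subtype.ext ?_
  refine (p.toCLM_ofMat _ ξ).trans ?_
  rw [p.project_of_pair_eq_zero T.pair_mat]
  have h : ξ = ∑ i, p.coeff ξ i • (⟨p.base i, p.base_mem i⟩ : perp p.J.1) := by
    refine Subtype.ext ((p.eq_coeff_vecMul_base ξ.2).trans ?_)
    funext l
    simp [vecMul, dotProduct]
  have h1 : T.toCLM ξ = ∑ i, p.coeff ξ i • T.toCLM ⟨p.base i, p.base_mem i⟩ :=
    (congr_arg T.toCLM h).trans (by simp only [map_sum, map_smul])
  refine Eq.trans ?_ (congr_arg Subtype.val h1).symm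
  funext l
  simp [vecMul, dotProduct, ChartIdx.Model.mat]

theorem ChartIdx.mat_ofMat (p : ChartIdx m Λ) {D : Matrix (Fin m) Λ ℂ}
    (h : pair D p.frame = 0) : (p.ofMat D).mat = D := by
  ext i l
  change ((p.ofMat D).toCLM ⟨p.base i, p.base_mem i⟩ : Λ → ℂ) l = _
  rw [p.toCLM_ofMat, p.project_of_pair_eq_zero h, p.coeff_base, single_one_vecMul]
  rfl

theorem ChartIdx.Model.continuous_mat_apply {p : ChartIdx m Λ} (i : Fin m) (l : Λ) :
    Continuous fun T : p.Model => T.mat i l := by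
  have h : Continuous fun T : perp p.J.1 →L[ℂ] perp p.J' => T ⟨p.base i, p.base_mem i⟩ :=
    continuous_eval_const _
  exact (continuous_apply l).comp (continuous_subtype_val.comp h)

/-- The model space of a chart as a retract of `ℂ^(m × Λ)`. -/
def ChartIdx.coords (p : ChartIdx m Λ) : Coords p.Model (Fin m × Λ) where
  toFun :=
    { toFun := fun T il => T.mat il.1 il.2
      map_add' := fun _ _ => rfl
      map_smul' := fun _ _ => rfl
      cont := continuous_pi fun il => ChartIdx.Model.continuous_mat_apply il.1 il.2 }
  retr :=
    { toFun := fun D => p.ofMat (Matrix.of (Function.curry D))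
      map_add' := p.retrLinear.map_add
      map_smul' := fun c D => p.retrLinear.map_smul (c : ℂ) D
      cont := p.continuous_retrLinear }
  retr_toFun := fun T => p.ofMat_mat T

instance (p : ChartIdx m Λ) : IsTopologicalAddGroup p.Model := p.coords.isTopologicalAddGroup

instance (p : ChartIdx m Λ) : ContinuousSMul ℝ p.Model := p.coords.continuousSMul

theorem ChartIdx.coords_apply (p : ChartIdx m Λ) (T : p.Model) (i : Fin m) (l : Λ) :
    p.coords.toFun T (i, l) = T.mat i l := rfl

theorem ChartIdx.continuous_ofMat (p : ChartIdx m Λ) : Continuous p.ofMat :=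
  p.continuous_retrLinear.comp (f := fun (D : Matrix (Fin m) Λ ℂ) (il : Fin m × Λ) => D il.1 il.2)
    (continuous_pi fun il => continuous_id.matrix_elem il.1 il.2)

theorem ChartIdx.Model.pair_base_add_mat {p : ChartIdx m Λ} (T : p.Model) :
    pair (p.base + T.mat) p.frame = 1 := by
  rw [pair_add, p.pair_base, T.pair_mat, add_zero]

/-- The chart of the Grassmannian given by `J` and a supplement `J'` of `J`. -/
def grChart (p : ChartIdx m Λ) : OpenPartialHomeomorph (Gr m Λ) p.Model where
  toFun K := p.ofMat (K.frameMat p.frame - p.base)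
  -- The rows `ξ_i + T ξ_i`, for the basis `ξ` of `J^⊥`, form a basis of the graph of `T`. They
  -- remain dual to the frame because `T ξ_i` is orthogonal to `J'`.
  invFun T := Gr.ofMatrix (p.base + T.mat) (ev_surjective T.pair_base_add_mat)
  source := chartDomain p.J'
  target := univ
  map_source' _ _ := mem_univ _
  map_target' T _ := by
    rw [← p.span_frame]
    exact (Gr.represents_ofMatrix _ _).mem_chartDomain T.pair_base_add_mat
  left_inv' K hK := by
    rw [← p.span_frame] at hK
    refine Subtype.ext ?_
    change LinearMap.ker (ev (p.base + (p.ofMat (K.frameMat p.frame - p.base)).mat)) = K.1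
    rw [p.mat_ofMat, add_sub_cancel]
    · exact K.represents_frameMat p.frame
    · rw [pair_sub, Gr.pair_frameMat hK, p.pair_base, sub_self]
  right_inv' T _ := by
    rw [(Gr.represents_ofMatrix _ _).frameMat_eq_self T.pair_base_add_mat, add_sub_cancel_left,
      p.ofMat_mat]
  open_source := by
    rw [← p.span_frame]
    exact isOpen_chartDomain_span _
  open_target := isOpen_univ
  continuousOn_toFun := by
    refine p.continuous_ofMat.comp_continuousOn ?_
    rw [← p.span_frame]
    refine continuousOn_pi.2 fun i => continuousOn_pi.2 fun l => ?_
    exact (Gr.continuousOn_frameMat p.frame i l).sub continuousOn_const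
  continuousOn_invFun := by
    refine Gr.continuousOn_of_represents (A := fun T : p.Model => p.base + T.mat) (fun i l => ?_)
      fun T _ => Gr.represents_ofMatrix _ _
    exact (continuous_const.add (ChartIdx.Model.continuous_mat_apply i l)).continuousOn

theorem grChart_apply (p : ChartIdx m Λ) (K : Gr m Λ) :
    grChart p K = p.ofMat (K.frameMat p.frame - p.base) := rfl

theorem grChart_source (p : ChartIdx m Λ) : (grChart p).source = chartDomain p.J' := rfl

theorem grChart_target (p : ChartIdx m Λ) : (grChart p).target = univ := rfl

theorem mem_grChart_source {p : ChartIdx m Λ} {K : Gr m Λ} :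
    K ∈ (grChart p).source ↔ K ∈ chartDomain (Submodule.span ℂ (range p.frame)) := by
  rw [p.span_frame, grChart_source]

theorem represents_grChart_symm (p : ChartIdx m Λ) (T : p.Model) :
    Represents (p.base + T.mat) ((grChart p).symm T) :=
  Gr.represents_ofMatrix _ (ev_surjective T.pair_base_add_mat)

theorem mat_grChart {p : ChartIdx m Λ} {K : Gr m Λ} (hK : K ∈ (grChart p).source) :
    (grChart p K).mat = K.frameMat p.frame - p.base := by
  rw [grChart_apply, p.mat_ofMat]
  rw [pair_sub, Gr.pair_frameMat (mem_grChart_source.1 hK), p.pair_base, sub_self]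

/-- The chart sends `K` to the linear map whose graph is `K^⊥`. -/
theorem perp_eq_range_graph {p : ChartIdx m Λ} {K : Gr m Λ} (hK : K ∈ (grChart p).source) :
    (perp K.1 : Set (Λ → ℂ)) =
      range fun ξ : perp p.J.1 => (ξ : Λ → ℂ) + ((grChart p K).toCLM ξ : Λ → ℂ) := by
  -- With `x` the coordinates of `ξ` in the basis `p.base`, one has `ξ + Tξ = x (base + (frameMat -
  -- base))`, a combination of the rows of the matrix of `K`.
  have key : ∀ ξ : perp p.J.1, (ξ : Λ → ℂ) + ((grChart p K).toCLM ξ : Λ → ℂ) =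
      p.coeff ξ ᵥ* K.frameMat p.frame := by
    intro ξ
    rw [grChart_apply, p.toCLM_ofMat, p.project_of_pair_eq_zero]
    · nth_rewrite 1 [p.eq_coeff_vecMul_base ξ.2]
      rw [← vecMul_add, add_sub_cancel]
    · rw [pair_sub, Gr.pair_frameMat (mem_grChart_source.1 hK), p.pair_base, sub_self]
  ext η
  rw [SetLike.mem_coe, (K.represents_frameMat p.frame).mem_perp_iff]
  constructor
  · rintro ⟨x, rfl⟩
    refine ⟨⟨x ᵥ* p.base, p.represents_base.mem_perp_iff.2 ⟨x, rfl⟩⟩, ?_⟩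
    refine (key _).trans ?_
    change p.coeff (x ᵥ* p.base) ᵥ* _ = _
    rw [p.coeff_vecMul, p.pair_base, vecMul_one]
  · rintro ⟨ξ, rfl⟩
    exact ⟨_, key ξ⟩

/-! ### Smoothness of maps to the Grassmannian -/

section Smooth

variable {E : Type v} [AddCommGroup E] [Module ℝ E] [TopologicalSpace E] {U : Set E}

theorem CylSmoothOn.ev {A : E → Matrix (Fin m) Λ ℂ}
    (hA : ∀ i l, CylSmoothOn (fun x => A x i l) U) (a : Λ →₀ ℂ) (i : Fin m) :
    CylSmoothOn (fun x => ev (A x) a i) U := by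
  simp only [ev_apply_sum]
  exact CylSmoothOn.sum _ fun l _ => (CylSmoothOn.const _).mul (hA i l)

/-- A family of subspaces represented by smooth matrices has smooth normalized matrices. -/
theorem CylSmoothOn.frameMat {A : E → Matrix (Fin m) Λ ℂ} {κ : E → Gr m Λ}
    (hA : ∀ i l, CylSmoothOn (fun x => A x i l) U) (h : ∀ x ∈ U, Represents (A x) (κ x))
    {v : Fin m → Λ →₀ ℂ} (hv : ∀ x ∈ U, κ x ∈ chartDomain (Submodule.span ℂ (range v)))
    (i : Fin m) (l : Λ) : CylSmoothOn (fun x => (κ x).frameMat v i l) U := by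
  have h1 : CylSmoothOn (fun x => ((pair (A x) v)⁻¹ * A x) i l) U :=
    CylSmoothOn.matrix_mul (CylSmoothOn.matrix_inv (fun i j => CylSmoothOn.ev hA (v j) i)
      fun x hx => (h x hx).mem_chartDomain_iff.1 (hv x hx)) hA i l
  exact h1.congr fun x hx => by simp only [(h x hx).frameMat_eq (hv x hx)]

theorem ChartIdx.cylSmoothOn_mat (p : ChartIdx m Λ) (U : Set p.Model) (i : Fin m) (l : Λ) :
    CylSmoothOn (fun T : p.Model => (p.base + T.mat) i l) U :=
  (CylSmoothOn.const _).add (p.coords.cylSmoothOn (i, l) U)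

theorem isFrechetManifold_grChart [Countable Λ] :
    IsFrechetManifold (fun p : ChartIdx m Λ => grChart p) where
  t2 := inferInstance
  frechet p := p.coords.isFrechetSpace
  cover K := by
    obtain ⟨v, -, hK, hc⟩ := K.exists_mem_chartDomain
    exact ⟨⟨K, _, hc⟩, hK⟩
  smooth_transition p q := by
    refine q.coords.smoothOn ((grChart p).isOpen_inter_preimage_symm (grChart q).open_source) ?_
    rintro ⟨i, l⟩
    refine CylSmoothOn.congr (f := fun T =>
      ((grChart p).symm T).frameMat q.frame i l - q.base i l) ?_ fun T hT => ?_
    · exact (CylSmoothOn.frameMat (p.cylSmoothOn_mat _) (fun T _ => represents_grChart_symm p T)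
        (fun T hT => mem_grChart_source.1 hT.2) i l).sub (CylSmoothOn.const _)
    · rw [q.coords_apply, mat_grChart hT.2]
      rfl

end Smooth

end Charts

/-! ### The bundle of the quotients `c_c(Λ) / J` -/

section QuotientBundle

open Matrix

variable {Λ : Type u} {m : ℕ}

/-- The coordinates of the quotient by `J` defined by a matrix which represents `J`. -/
def Represents.quotEquiv {A : Matrix (Fin m) Λ ℂ} {J : Gr m Λ} (h : Represents A J) :
    quotFiber m Λ J ≃ₗ[ℂ] (Fin m → ℂ) :=
  (Submodule.quotEquivOfEq _ _ h.symm).trans ((ev A).quotKerEquivOfSurjective h.surjective)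

/-- The coordinates of the quotient by `J` with respect to the family `v`. -/
def quotCoord (J : Gr m Λ) (v : Fin m → Λ →₀ ℂ) : quotFiber m Λ J ≃ₗ[ℂ] (Fin m → ℂ) :=
  (J.represents_frameMat v).quotEquiv

theorem quotCoord_mk (J : Gr m Λ) (v : Fin m → Λ →₀ ℂ) (a : Λ →₀ ℂ) :
    quotCoord J v (Submodule.Quotient.mk a) = ev (J.frameMat v) a := rfl

theorem quotCoord_symm {J : Gr m Λ} {v : Fin m → Λ →₀ ℂ}
    (h : J ∈ chartDomain (Submodule.span ℂ (range v))) (x : Fin m → ℂ) :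
    (quotCoord J v).symm x = Submodule.Quotient.mk (∑ i, x i • v i) := by
  rw [LinearEquiv.symm_apply_eq, quotCoord_mk, ev_sum_smul, Gr.pair_frameMat h, one_mulVec]

/-- The pretrivialization of the bundle of quotients given by the family `v`. -/
def quotPretrivialization (v : Fin m → Λ →₀ ℂ) :
    Pretrivialization (Fin m → ℂ) (π (Fin m → ℂ) (quotFiber m Λ)) where
  -- `quotCoord` is an isomorphism for every `J`; only inside `U_v` does it give the coordinates
  -- with respect to `v`. The inverse identities therefore hold without restriction.
  toFun z := (z.1, quotCoord z.1 v z.2)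
  invFun p := ⟨p.1, (quotCoord p.1 v).symm p.2⟩
  source := TotalSpace.proj ⁻¹' chartDomain (Submodule.span ℂ (range v))
  target := chartDomain (Submodule.span ℂ (range v)) ×ˢ univ
  map_source' z hz := ⟨hz, trivial⟩
  map_target' p hp := hp.1
  left_inv' z hz := by
    simp only [LinearEquiv.symm_apply_apply]
  right_inv' p hp := by
    simp only [LinearEquiv.apply_symm_apply]
  open_target := (isOpen_chartDomain_span v).prod isOpen_univ
  baseSet := chartDomain (Submodule.span ℂ (range v))
  open_baseSet := isOpen_chartDomain_span v
  source_eq := rfl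
  target_eq := rfl
  proj_toFun _ _ := rfl

theorem quotPretrivialization_apply (v : Fin m → Λ →₀ ℂ) (J : Gr m Λ) (y : quotFiber m Λ J) :
    quotPretrivialization v ⟨J, y⟩ = (J, quotCoord J v y) := rfl

theorem quotPretrivialization_symm {v : Fin m → Λ →₀ ℂ} {J : Gr m Λ}
    (h : J ∈ chartDomain (Submodule.span ℂ (range v))) (x : Fin m → ℂ) :
    (⟨J, (quotPretrivialization v).symm J x⟩ : TotalSpace (Fin m → ℂ) (quotFiber m Λ)) =
      ⟨J, Submodule.Quotient.mk (∑ i, x i • v i)⟩ := by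
  rw [(quotPretrivialization v).mk_symm h, ← quotCoord_symm h]
  rfl

/-- Matrices as continuous linear maps. -/
def matrixCLM (m : ℕ) : Matrix (Fin m) (Fin m) ℂ →ₗ[ℂ] ((Fin m → ℂ) →L[ℂ] (Fin m → ℂ)) :=
  LinearMap.toContinuousLinearMap.toLinearMap ∘ₗ Matrix.toLin'.toLinearMap

theorem matrixCLM_apply (M : Matrix (Fin m) (Fin m) ℂ) (x : Fin m → ℂ) :
    matrixCLM m M x = M *ᵥ x := rfl

theorem quotPretrivialization_coordChange {v w : Fin m → Λ →₀ ℂ} {J : Gr m Λ}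
    (h : J ∈ chartDomain (Submodule.span ℂ (range v))) (x : Fin m → ℂ) :
    (quotPretrivialization w ⟨J, (quotPretrivialization v).symm J x⟩).2 =
      matrixCLM m (pair (J.frameMat w) v) x := by
  rw [quotPretrivialization_symm h, quotPretrivialization_apply, quotCoord_mk, ev_sum_smul,
    matrixCLM_apply]

/-- The topology of the fibers of the bundle of quotients. -/

abbrev quotFiberTopology (J : Gr m Λ) : TopologicalSpace (quotFiber m Λ J) :=
  TopologicalSpace.induced (quotCoord J J.exists_mem_chartDomain.choose) inferInstance

attribute [local instance] quotFiberTopology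

variable (Λ m) in
/-- The structure of a vector bundle on the quotients `c_c(Λ) / J`. -/
def quotPrebundle : VectorPrebundle ℂ (Fin m → ℂ) (quotFiber m Λ) where
  pretrivializationAtlas := {e | ∃ v : Fin m → Λ →₀ ℂ, e = quotPretrivialization v}
  pretrivialization_linear' := by
    rintro _ ⟨v, rfl⟩
    exact ⟨fun J _ => ⟨fun x y => map_add (quotCoord J v) x y,
      fun c x => map_smul (quotCoord J v) c x⟩⟩
  pretrivializationAt J := quotPretrivialization J.exists_mem_chartDomain.choose
  mem_base_pretrivializationAt J := J.exists_mem_chartDomain.choose_spec.2.1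
  pretrivialization_mem_atlas J := ⟨_, rfl⟩
  exists_coordChange := by
    rintro _ ⟨v, rfl⟩ _ ⟨w, rfl⟩
    refine ⟨fun J => matrixCLM m (pair (J.frameMat w) v), ?_, fun J hJ x =>
      (quotPretrivialization_coordChange hJ.1 x).symm⟩
    refine (matrixCLM m).continuous_of_finiteDimensional.comp_continuousOn ?_
    refine continuousOn_pi.2 fun i => continuousOn_pi.2 fun j => ?_
    simp only [pair_apply, ev_apply_sum]
    refine continuousOn_finsetSum _ fun l _ => continuousOn_const.mul ?_
    exact (Gr.continuousOn_frameMat w i l).mono inter_subset_right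
  totalSpaceMk_isInducing J := by
    have h : IsInducing (quotCoord J J.exists_mem_chartDomain.choose) := ⟨rfl⟩
    exact (Topology.isInducing_const_prod (x := J)).2 h

/-- A retraction of `ℂ^(m × m)` onto the endomorphisms of `ℂ^m`. -/
def matrixRetr (m : ℕ) : (Fin m × Fin m → ℂ) →L[ℝ] ((Fin m → ℂ) →L[ℂ] (Fin m → ℂ)) :=
  LinearMap.toContinuousLinearMap
    { toFun := fun M => matrixCLM m (Matrix.of (Function.curry M))
      map_add' := fun M _ => (matrixCLM m).map_add (Matrix.of (Function.curry M)) _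
      map_smul' := fun c M => (matrixCLM m).map_smul (c : ℂ) (Matrix.of (Function.curry M)) }

/-- The coordinate changes between the trivializations given by families of vectors are smooth. -/
theorem smoothOn_matrixCLM_pair (p : ChartIdx m Λ) (v w : Fin m → Λ →₀ ℂ)
    {U : Set p.Model} (hU : IsOpen U)
    (hw : ∀ T ∈ U, (grChart p).symm T ∈ chartDomain (Submodule.span ℂ (range w))) :
    SmoothOn (fun T => matrixCLM m (pair (((grChart p).symm T).frameMat w) v)) U := by
  have h : ∀ ij : Fin m × Fin m, CylSmoothOn
      (fun T => pair (((grChart p).symm T).frameMat w) v ij.1 ij.2) U := fun ij =>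
    CylSmoothOn.ev (CylSmoothOn.frameMat (p.cylSmoothOn_mat _)
      (fun T _ => represents_grChart_symm p T) hw) _ _
  intro n
  exact (CkOn.pi (f := fun T (ij : Fin m × Fin m) =>
    pair (((grChart p).symm T).frameMat w) v ij.1 ij.2)
    fun ij => (h ij).smoothOn hU n).clm_comp (matrixRetr m)

variable (Λ m) in
/-- The quotients `c_c(Λ) / J` form a smooth vector bundle. -/
theorem exists_quotient_bundle :
    ∃ (_ : TopologicalSpace (TotalSpace (Fin m → ℂ) (quotFiber m Λ)))
      (_ : ∀ J, TopologicalSpace (quotFiber m Λ J))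
      (_ : FiberBundle (Fin m → ℂ) (quotFiber m Λ))
      (_ : VectorBundle ℂ (Fin m → ℂ) (quotFiber m Λ)),
      IsSmoothVectorBundle (fun p : ChartIdx m Λ => grChart p) (Fin m → ℂ) (quotFiber m Λ) ∧
      ∀ v : Fin m → (Λ →₀ ℂ), LinearIndependent ℂ v →
        ∃ e ∈ FiberBundle.trivializationAtlas (Fin m → ℂ) (quotFiber m Λ),
          e.baseSet = chartDomain (Submodule.span ℂ (range v)) ∧
          ∀ J ∈ e.baseSet, ∀ x : Fin m → ℂ,
            e ⟨J, Submodule.Quotient.mk (∑ i, x i • v i)⟩ = (J, x) := by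
  let := (quotPrebundle Λ m).totalSpaceTopology
  let := (quotPrebundle Λ m).toFiberBundle
  have := (quotPrebundle Λ m).toVectorBundle
  refine ⟨_, quotFiberTopology, _, this, ?_, ?_⟩
  · intro e e' he he' p
    -- The formula is recorded while `e` and `e'` are still abstract; once they are unfolded it
    -- becomes a statement about pretrivializations.
    have hcc : ∀ J ∈ e.baseSet ∩ e'.baseSet, ∀ x, e.coordChangeL ℂ e' J x = (e' ⟨J, e.symm J x⟩).2 :=
      fun J hJ x => Trivialization.coordChangeL_apply e e' hJ x
    obtain ⟨_, ⟨v, rfl⟩, rfl⟩ := he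
    obtain ⟨_, ⟨w, rfl⟩, rfl⟩ := he'
    have hU := (grChart p).isOpen_inter_preimage_symm
      ((isOpen_chartDomain_span v).inter (isOpen_chartDomain_span w))
    refine SmoothOn.congr hU (smoothOn_matrixCLM_pair p v w hU fun T hT => hT.2.2) fun T hT => ?_
    refine ContinuousLinearMap.ext fun x => ?_
    exact (hcc _ hT.2 x).trans (quotPretrivialization_coordChange hT.2.1 x)
  · intro v _
    refine ⟨(quotPrebundle Λ m).trivializationOfMemPretrivializationAtlas ⟨v, rfl⟩,
      ⟨_, ⟨v, rfl⟩, rfl⟩, rfl, fun J hJ x => ?_⟩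
    change (J, quotCoord J v _) = _
    rw [← quotCoord_symm hJ, LinearEquiv.apply_symm_apply]

end QuotientBundle

/-! ### Hermitian forms on finite-dimensional spaces -/

section HermitianForms

variable {V : Type u} [AddCommGroup V] [Module ℂ V] {m : ℕ}

theorem HermForm.conj_apply (h : HermForm V) (x y : V) : conj (h.1 x y) = h.1 y x := (h.2 x y).symm

theorem HermForm.ext_apply {h k : HermForm V} (H : ∀ x y, h.1 x y = k.1 x y) : h = k :=
  Subtype.ext (LinearMap.ext fun x => LinearMap.ext fun y => H x y)

theorem HermForm.continuous_apply (x y : V) : Continuous fun h : HermForm V => h.1 x y := by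
  have h : Continuous fun (h : HermForm V) (x y : V) => h.1 x y := continuous_induced_dom
  exact (_root_.continuous_apply y).comp ((_root_.continuous_apply x).comp h)

theorem HermForm.continuous_rng {X : Type*} [TopologicalSpace X] {f : X → HermForm V}
    (hf : ∀ x y, Continuous fun t => (f t).1 x y) : Continuous f :=
  continuous_induced_rng.2 (continuous_pi fun x => continuous_pi fun y => hf x y)

theorem HermForm.apply_self_im (h : HermForm V) (x : V) : (h.1 x x).im = 0 :=
  Complex.conj_eq_iff_im.1 (HermForm.conj_apply h x x)

theorem HermForm.smul_smul (h : HermForm V) (c d : ℂ) (x y : V) :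
    h.1 (c • x) (d • y) = conj c * d * h.1 x y := by
  rw [map_smul, LinearMap.map_smulₛₗ h.1, LinearMap.smul_apply, smul_eq_mul, smul_eq_mul]
  ring

/-- A Hermitian form belongs to the cone if and only if it is positive definite. -/
theorem mem_posCone_iff {h : HermForm V} : h ∈ posCone V ↔ ∀ x, x ≠ 0 → 0 < (h.1 x x).re := by
  constructor
  · rintro ⟨hpos, hnd⟩ x hx
    refine (hpos x).lt_of_ne fun h0 => hx (hnd x fun y => ?_)
    by_contra hw
    set w := h.1 x y with hw_def
    have hwpos : 0 < Complex.normSq w := Complex.normSq_pos.2 hw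
    set r := (h.1 y y).re
    have hall : ∀ t : ℝ, 0 ≤ r - 2 * t * Complex.normSq w := by
      intro t
      have h1 := hpos (y + (-(t : ℂ) * w) • x)
      rw [map_add h.1, LinearMap.add_apply, map_add, map_add, HermForm.smul_smul, map_smul,
        LinearMap.map_smulₛₗ h.1, LinearMap.smul_apply, ← HermForm.conj_apply h x y, ← hw_def,
        smul_eq_mul, smul_eq_mul] at h1
      have h2 : conj (-(t : ℂ) * w) * (-(t : ℂ) * w) * h.1 x x =
          ((t ^ 2 * Complex.normSq w : ℝ) : ℂ) * h.1 x x := by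
        rw [Complex.ofReal_mul, Complex.normSq_eq_conj_mul_self, map_mul, map_neg,
          Complex.conj_ofReal, Complex.ofReal_pow]
        ring
      have h3 : (-(t : ℂ) * w) * conj w = ((-(t * Complex.normSq w) : ℝ) : ℂ) := by
        rw [Complex.ofReal_neg, Complex.ofReal_mul, Complex.normSq_eq_conj_mul_self]
        ring
      have h4 : conj (-(t : ℂ) * w) * w = ((-(t * Complex.normSq w) : ℝ) : ℂ) := by
        rw [Complex.ofReal_neg, Complex.ofReal_mul, Complex.normSq_eq_conj_mul_self]
        simp
        ring
      rw [h2, h3, h4] at h1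
      simp only [Complex.add_re, Complex.re_ofReal_mul, Complex.ofReal_re, ← h0] at h1
      linarith
    have h1 := hall ((r + 1) / (2 * Complex.normSq w))
    have h2 : 2 * ((r + 1) / (2 * Complex.normSq w)) * Complex.normSq w = r + 1 := by
      field_simp
    rw [h2] at h1
    linarith
  · intro hh
    refine ⟨fun x => ?_, fun x hx => ?_⟩
    · by_cases hx : x = 0
      · simp [hx]
      · exact (hh x hx).le
    · by_contra hx0
      have h1 := hh x hx0
      rw [hx x] at h1
      exact lt_irrefl _ h1

theorem convex_posCone : Convex ℝ (posCone V) := by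
  intro h hh k hk a b ha hb hab
  rw [mem_posCone_iff] at *
  intro x hx
  change 0 < (((a : ℂ) * h.1 x x) + ((b : ℂ) * k.1 x x)).re
  simp only [Complex.add_re, Complex.re_ofReal_mul]
  -- Strict positivity must come from a nonzero weight: from `k` alone if `a = 0`, and from `h`
  -- otherwise.
  rcases ha.eq_or_lt with rfl | ha
  · have hb1 : b = 1 := by linarith
    simpa [hb1] using hk x hx
  · exact add_pos_of_pos_of_nonneg (mul_pos ha (hh x hx)) (mul_nonneg hb (hk x hx).le)

theorem smul_mem_posCone {t : ℝ} (ht : 0 < t) {h : HermForm V} (hh : h ∈ posCone V) :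
    t • h ∈ posCone V := by
  rw [mem_posCone_iff] at *
  intro x hx
  change 0 < ((t : ℂ) * h.1 x x).re
  rw [Complex.re_ofReal_mul]
  exact mul_pos ht (hh x hx)

/-- The sesquilinear form with a given matrix in a basis. -/
def sesqOfMatrix (b : Module.Basis (Fin m) ℂ V) (M : Fin m × Fin m → ℂ) : V →ₗ⋆[ℂ] V →ₗ[ℂ] ℂ :=
  LinearMap.mk₂'ₛₗ (starRingEnd ℂ) (RingHom.id ℂ)
    (fun x y => ∑ i, ∑ j, conj (b.repr x i) * M (i, j) * b.repr y j)
    (fun x x' y => by simp [add_mul, Finset.sum_add_distrib])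
    (fun c x y => by simp [mul_assoc, Finset.mul_sum])
    (fun x y y' => by simp [mul_add, Finset.sum_add_distrib])
    (fun c x y => by
      simp only [map_smul, Finsupp.smul_apply, smul_eq_mul, Finset.mul_sum, RingHom.id_apply]
      exact Finset.sum_congr rfl fun _ _ => Finset.sum_congr rfl fun _ _ => by ring)

theorem sesqOfMatrix_apply (b : Module.Basis (Fin m) ℂ V) (M : Fin m × Fin m → ℂ) (x y : V) :
    sesqOfMatrix b M x y = ∑ i, ∑ j, conj (b.repr x i) * M (i, j) * b.repr y j := rfl

theorem sesqOfMatrix_basis (b : Module.Basis (Fin m) ℂ V) (M : Fin m × Fin m → ℂ) (i j : Fin m) :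
    sesqOfMatrix b M (b i) (b j) = M (i, j) := by
  rw [sesqOfMatrix_apply]
  simp [Finsupp.single_apply]

/-- The Hermitian part of a matrix. -/
def hermPart (M : Fin m × Fin m → ℂ) : Fin m × Fin m → ℂ :=
  fun ij => (M ij + conj (M (ij.2, ij.1))) / 2

/-- The Hermitian form given by the Hermitian part of a matrix. -/
def HermForm.ofMatrix (b : Module.Basis (Fin m) ℂ V) (M : Fin m × Fin m → ℂ) : HermForm V :=
  ⟨sesqOfMatrix b (hermPart M), fun x y => by
    simp only [sesqOfMatrix_apply, map_sum, map_mul, Complex.conj_conj, hermPart, map_div₀, map_add,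
      map_ofNat]
    rw [Finset.sum_comm]
    exact Finset.sum_congr rfl fun _ _ => Finset.sum_congr rfl fun _ _ => by ring⟩

theorem HermForm.ofMatrix_apply (b : Module.Basis (Fin m) ℂ V) (M : Fin m × Fin m → ℂ) (x y : V) :
    (HermForm.ofMatrix b M).1 x y =
      ∑ i, ∑ j, conj (b.repr x i) * hermPart M (i, j) * b.repr y j := rfl

theorem HermForm.apply_eq_sum (b : Module.Basis (Fin m) ℂ V) (h : HermForm V) (x y : V) :
    h.1 x y = ∑ i, ∑ j, conj (b.repr x i) * h.1 (b i) (b j) * b.repr y j := by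
  have h1 : h.1 x y = h.1 (∑ i, b.repr x i • b i) (∑ j, b.repr y j • b j) := by
    rw [b.sum_repr, b.sum_repr]
  rw [h1, map_sum h.1, LinearMap.sum_apply]
  refine Finset.sum_congr rfl fun i _ => ?_
  rw [map_sum]
  refine Finset.sum_congr rfl fun j _ => ?_
  rw [HermForm.smul_smul]
  ring

/-- The Hermitian forms as a retract of the space of matrices. -/
def HermForm.coords (b : Module.Basis (Fin m) ℂ V) : Coords (HermForm V) (Fin m × Fin m) where
  toFun :=
    { toFun := fun h ij => h.1 (b ij.1) (b ij.2)
      map_add' := fun _ _ => rfl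
      map_smul' := fun _ _ => rfl
      cont := continuous_pi fun ij => HermForm.continuous_apply _ _ }
  retr :=
    { toFun := HermForm.ofMatrix b
      map_add' := fun M N => HermForm.ext_apply fun x y => by
        change _ = (HermForm.ofMatrix b M).1 x y + (HermForm.ofMatrix b N).1 x y
        simp only [HermForm.ofMatrix_apply, ← Finset.sum_add_distrib, hermPart, Pi.add_apply,
          map_add]
        exact Finset.sum_congr rfl fun _ _ => Finset.sum_congr rfl fun _ _ => by ring
      map_smul' := fun c M => HermForm.ext_apply fun x y => by
        change _ = (c : ℂ) * (HermForm.ofMatrix b M).1 x y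
        simp only [HermForm.ofMatrix_apply, Finset.mul_sum, hermPart, Pi.smul_apply,
          Complex.real_smul, map_mul, Complex.conj_ofReal]
        exact Finset.sum_congr rfl fun _ _ => Finset.sum_congr rfl fun _ _ => by ring
      cont := HermForm.continuous_rng fun x y => by
        simp only [HermForm.ofMatrix_apply, hermPart]
        have hc : Continuous fun z : ℂ => conj z := Complex.continuous_conj
        fun_prop }
  retr_toFun h := HermForm.ext_apply fun x y => by
    refine (HermForm.ofMatrix_apply b _ x y).trans ?_
    rw [HermForm.apply_eq_sum b h x y]
    refine Finset.sum_congr rfl fun i _ => Finset.sum_congr rfl fun j _ => ?_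
    have h1 : hermPart (fun ij : Fin m × Fin m => h.1 (b ij.1) (b ij.2)) (i, j) =
        h.1 (b i) (b j) := by
      simp [hermPart, HermForm.conj_apply]
    exact congr_arg (fun z => conj (b.repr x i) * z * b.repr y j) h1

theorem HermForm.coords_apply (b : Module.Basis (Fin m) ℂ V) (h : HermForm V) (i j : Fin m) :
    (HermForm.coords b).toFun h (i, j) = h.1 (b i) (b j) := rfl

theorem HermForm.coords_ofMatrix (b : Module.Basis (Fin m) ℂ V) (M : Fin m × Fin m → ℂ) :
    (HermForm.coords b).toFun (HermForm.ofMatrix b M) = hermPart M :=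
  funext fun _ => sesqOfMatrix_basis b _ _ _

theorem HermForm.ofMatrix_coords (b : Module.Basis (Fin m) ℂ V) (h : HermForm V) :
    HermForm.ofMatrix b ((HermForm.coords b).toFun h) = h := (HermForm.coords b).retr_toFun h

/-- Every matrix is `h + i k`, with Hermitian `h` and `k`. -/
def HermForm.prodEquiv (b : Module.Basis (Fin m) ℂ V) :
    (HermForm V × HermForm V) ≃ₗ[ℝ] (Fin m × Fin m → ℂ) where
  toFun p := fun ij => (HermForm.coords b).toFun p.1 ij + Complex.I * (HermForm.coords b).toFun p.2 ij
  map_add' p q := by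
    funext ij
    simp only [Prod.fst_add, Prod.snd_add, map_add, Pi.add_apply]
    ring
  map_smul' c p := by
    funext ij
    simp only [Prod.smul_fst, Prod.smul_snd, map_smul, Pi.smul_apply, Complex.real_smul,
      RingHom.id_apply]
    ring
  invFun M := (HermForm.ofMatrix b M, HermForm.ofMatrix b fun ij => -Complex.I * M ij)
  left_inv p := by
    obtain ⟨h, k⟩ := p
    have hI := Complex.I_mul_I
    refine Prod.ext ((HermForm.coords b).isEmbedding.injective ?_)
      ((HermForm.coords b).isEmbedding.injective ?_)
    · refine (HermForm.coords_ofMatrix b _).trans (funext fun ⟨i, j⟩ => ?_)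
      simp only [hermPart, HermForm.coords_apply, map_add, map_mul, Complex.conj_I,
        HermForm.conj_apply]
      ring
    · refine (HermForm.coords_ofMatrix b _).trans (funext fun ⟨i, j⟩ => ?_)
      simp only [hermPart, HermForm.coords_apply, map_add, map_mul, map_neg, Complex.conj_I,
        HermForm.conj_apply]
      linear_combination (-k.1 (b i) (b j)) * hI
  right_inv M := by
    funext ⟨i, j⟩
    have hI := Complex.I_mul_I
    simp only [HermForm.coords_ofMatrix, hermPart, map_mul, map_neg, Complex.conj_I]
    linear_combination (-M (i, j) / 2 + conj (M (j, i)) / 2) * hI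

/-- Two copies of the Hermitian forms make up all complex `m × m` matrices, whose real dimension is
`2 m²`. -/
theorem HermForm.finrank_eq (b : Module.Basis (Fin m) ℂ V) :
    Module.finrank ℝ (HermForm V) = m ^ 2 := by
  have hfin : Module.Finite ℝ (HermForm V) :=
    Module.Finite.of_injective (HermForm.coords b).toFun.toLinearMap
      (HermForm.coords b).isEmbedding.injective
  have hfree : Module.Free ℝ (HermForm V) :=
    @Module.Free.of_divisionRing ℝ (HermForm V) _ (HermForm V).addCommGroup (HermForm V).module
  have h := (HermForm.prodEquiv b).finrank_eq
  rw [Module.finrank_prod, Module.finrank_pi_fintype] at h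
  simp only [Complex.finrank_real_complex, Finset.sum_const, Finset.card_univ, Fintype.card_prod,
    Fintype.card_fin, smul_eq_mul] at h
  rw [sq]
  omega

/-- Positive definiteness need only be tested on the unit sphere of `ℂ^m`; by compactness,
positivity there persists for nearby forms, and homogeneity extends it to all vectors. -/
theorem isOpen_posCone (b : Module.Basis (Fin m) ℂ V) : IsOpen (posCone V) := by
  have hcont : Continuous fun p : HermForm V × (Fin m → ℂ) =>
      (p.1.1 (∑ i, p.2 i • b i) (∑ i, p.2 i • b i)).re := by
    have h1 : (fun p : HermForm V × (Fin m → ℂ) =>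
        (p.1.1 (∑ i, p.2 i • b i) (∑ i, p.2 i • b i)).re) =
        fun p => (∑ i, ∑ j, conj (p.2 i) * p.1.1 (b i) (b j) * p.2 j).re := by
      funext p
      rw [HermForm.apply_eq_sum b p.1]
      simp only [b.repr_sum_self]
    rw [h1]
    have h2 : ∀ i j, Continuous fun p : HermForm V × (Fin m → ℂ) => p.1.1 (b i) (b j) :=
      fun i j => (HermForm.continuous_apply _ _).comp continuous_fst
    have hc : Continuous fun z : ℂ => conj z := Complex.continuous_conj
    refine Complex.continuous_re.comp ?_
    refine continuous_finsetSum _ fun i _ => continuous_finsetSum _ fun j _ => ?_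
    exact ((hc.comp ((_root_.continuous_apply i).comp continuous_snd)).mul (h2 i j)).mul
      ((_root_.continuous_apply j).comp continuous_snd)
  rw [isOpen_iff_eventually]
  intro h hh
  rw [mem_posCone_iff] at hh
  have h1 : ∀ᶠ k in 𝓝 h, ∀ x ∈ Metric.sphere (0 : Fin m → ℂ) 1,
      0 < (k.1 (∑ i, x i • b i) (∑ i, x i • b i)).re := by
    refine (isCompact_sphere (0 : Fin m → ℂ) 1).eventually_forall_of_forall_eventually
      fun x hx => ?_
    refine hcont.continuousAt.eventually (lt_mem_nhds (hh _ fun h0 => ?_))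
    have hx0 : x = 0 := funext fun i => Fintype.linearIndependent_iff.1 b.linearIndependent x h0 i
    rw [hx0] at hx
    simp at hx
  filter_upwards [h1] with k hk
  rw [mem_posCone_iff]
  intro x hx
  set y : Fin m → ℂ := fun i => b.repr x i with hy
  have hxy : ∑ i, y i • b i = x := b.sum_repr x
  have hy0 : 0 < ‖y‖ := norm_pos_iff.2 fun h0 => hx (by rw [← hxy, h0]; simp)
  have h2 := hk ((‖y‖⁻¹ : ℂ) • y) (by
    rw [mem_sphere_zero_iff_norm, norm_smul, norm_inv, Complex.norm_real, norm_norm,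
      inv_mul_cancel₀ hy0.ne'])
  simp only [Pi.smul_apply, smul_assoc, ← Finset.smul_sum, hxy] at h2
  rw [HermForm.smul_smul, ← Complex.ofReal_inv, Complex.conj_ofReal, ← Complex.ofReal_mul,
    Complex.re_ofReal_mul] at h2
  exact pos_of_mul_pos_right h2 (by positivity)

variable (m) in
/-- The cone contains the standard Hermitian form on `ℂ^m`. -/
theorem nonempty_posCone : (posCone (Fin m → ℂ)).Nonempty := by
  refine ⟨HermForm.ofMatrix (Pi.basisFun ℂ (Fin m)) fun ij => if ij.1 = ij.2 then 1 else 0, ?_⟩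
  rw [mem_posCone_iff]
  intro x hx
  have h1 : ∀ i j : Fin m, hermPart (fun ij : Fin m × Fin m =>
      if ij.1 = ij.2 then (1 : ℂ) else 0) (i, j) = if i = j then 1 else 0 := by
    intro i j
    by_cases h : i = j
    · simp [hermPart, h]
    · simp [hermPart, h, Ne.symm h]
  simp only [HermForm.ofMatrix_apply, h1, Pi.basisFun_repr, mul_ite, mul_one, mul_zero, ite_mul,
    zero_mul, Finset.sum_ite_eq, Finset.mem_univ, if_true, Complex.re_sum]
  obtain ⟨i, hi⟩ := Function.ne_iff.1 hx
  have h2 : ∀ z : ℂ, (conj z * z).re = Complex.normSq z := fun z => by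
    rw [← Complex.normSq_eq_conj_mul_self, Complex.ofReal_re]
  simp only [h2]
  exact Finset.sum_pos' (fun _ _ => Complex.normSq_nonneg _)
    ⟨i, Finset.mem_univ i, Complex.normSq_pos.2 hi⟩

end HermitianForms

/-! ### Positive Hermitian forms of rank `m` on `c_c(Λ)` -/

section PositiveForms

variable {Λ : Type u} {m : ℕ}

theorem rhoInner_eq_sum (ρ : Matrix Λ Λ ℂ) (a b : Λ →₀ ℂ) :
    rhoInner ρ a b = ∑ l ∈ a.support, ∑ k ∈ b.support, conj (a l) * ρ l k * b k := rfl

theorem rhoInner_add_left (ρ : Matrix Λ Λ ℂ) (a a' b : Λ →₀ ℂ) :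
    rhoInner ρ (a + a') b = rhoInner ρ a b + rhoInner ρ a' b := by
  classical
  refine Finsupp.sum_add_index' (by simp) fun i x y => ?_
  simp only [Finsupp.sum, map_add, add_mul, Finset.sum_add_distrib]

theorem rhoInner_add_right (ρ : Matrix Λ Λ ℂ) (a b b' : Λ →₀ ℂ) :
    rhoInner ρ a (b + b') = rhoInner ρ a b + rhoInner ρ a b' := by
  classical
  simp only [rhoInner]
  rw [← Finsupp.sum_add]
  refine Finsupp.sum_congr fun i _ => ?_
  exact Finsupp.sum_add_index' (by simp) (by intros; ring)

theorem rhoInner_smul_left (ρ : Matrix Λ Λ ℂ) (c : ℂ) (a b : Λ →₀ ℂ) :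
    rhoInner ρ (c • a) b = conj c * rhoInner ρ a b := by
  simp only [rhoInner]
  rw [Finsupp.sum_smul_index' (by simp)]
  simp only [Finsupp.sum, Finset.mul_sum, smul_eq_mul, map_mul, mul_assoc]

theorem rhoInner_smul_right (ρ : Matrix Λ Λ ℂ) (c : ℂ) (a b : Λ →₀ ℂ) :
    rhoInner ρ a (c • b) = c * rhoInner ρ a b := by
  simp only [rhoInner, Finsupp.sum, Finset.mul_sum]
  refine Finset.sum_congr rfl fun i _ => ?_
  have h := Finsupp.sum_smul_index' (g := b) (b := c)
    (h := fun k y => conj (a i) * ρ i k * y) (by simp)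
  simp only [Finsupp.sum] at h
  rw [h]
  exact Finset.sum_congr rfl fun _ _ => by rw [smul_eq_mul]; ring

theorem rhoInner_single (ρ : Matrix Λ Λ ℂ) (l k : Λ) :
    rhoInner ρ (Finsupp.single l 1) (Finsupp.single k 1) = ρ l k := by
  rw [rhoInner, Finsupp.sum_single_index (by simp), Finsupp.sum_single_index (by simp)]
  simp

/-- The sesquilinear form `⟨a, b⟩_ρ`. -/
def rhoForm (ρ : Matrix Λ Λ ℂ) : (Λ →₀ ℂ) →ₗ⋆[ℂ] (Λ →₀ ℂ) →ₗ[ℂ] ℂ :=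
  LinearMap.mk₂'ₛₗ (starRingEnd ℂ) (RingHom.id ℂ) (rhoInner ρ) (rhoInner_add_left ρ)
    (rhoInner_smul_left ρ) (rhoInner_add_right ρ) (rhoInner_smul_right ρ)

theorem rhoForm_apply (ρ : Matrix Λ Λ ℂ) (a b : Λ →₀ ℂ) : rhoForm ρ a b = rhoInner ρ a b := rfl

theorem Matrix.IsHermitian.conj_rhoInner {ρ : Matrix Λ Λ ℂ} (hρ : ρ.IsHermitian) (a b : Λ →₀ ℂ) :
    conj (rhoInner ρ a b) = rhoInner ρ b a := by
  simp only [rhoInner, Finsupp.sum, map_sum, map_mul, Complex.conj_conj]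
  rw [Finset.sum_comm]
  refine Finset.sum_congr rfl fun i _ => Finset.sum_congr rfl fun k _ => ?_
  have h : conj (ρ k i) = ρ i k := hρ.apply i k
  rw [h]
  ring

/-- The matrix of a sesquilinear form on `c_c(Λ)` determines it. -/
theorem rhoInner_of_sesq (B : (Λ →₀ ℂ) →ₗ⋆[ℂ] (Λ →₀ ℂ) →ₗ[ℂ] ℂ) (a b : Λ →₀ ℂ) :
    rhoInner (Matrix.of fun l k => B (Finsupp.single l 1) (Finsupp.single k 1)) a b = B a b := by
  have h : ∀ (l : Λ) (x : ℂ), Finsupp.single l x = x • Finsupp.single l (1 : ℂ) := by simp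
  induction a using Finsupp.induction_linear with
  | zero => simp [rhoInner]
  | add a a' ha ha' => rw [rhoInner_add_left, ha, ha', map_add, LinearMap.add_apply]
  | single l x =>
    induction b using Finsupp.induction_linear with
    | zero => simp [rhoInner]
    | add b b' hb hb' => rw [rhoInner_add_right, hb, hb', map_add]
    | single k y =>
      rw [h l x, h k y, rhoInner_smul_left, rhoInner_smul_right, rhoInner_single, map_smul,
        LinearMap.map_smulₛₗ B, LinearMap.smul_apply, smul_eq_mul, smul_eq_mul, Matrix.of_apply]
      ring

theorem rhoInner_of_mem_radical {ρ : Matrix Λ Λ ℂ} (a : Λ →₀ ℂ) {b : Λ →₀ ℂ}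
    (hb : b ∈ radical ρ) : rhoInner ρ a b = 0 := by
  refine Finset.sum_eq_zero fun l _ => ?_
  have h := hb l
  simp only [Finsupp.sum] at h ⊢
  simp only [mul_assoc, ← Finset.mul_sum, h, mul_zero]

/-- The form `⟨a, b⟩_ρ` only depends on `a` and `b` modulo the radical. -/
theorem rhoInner_congr {ρ : Matrix Λ Λ ℂ} (hρ : ρ.IsHermitian) {a a' b b' : Λ →₀ ℂ}
    (ha : a - a' ∈ radical ρ) (hb : b - b' ∈ radical ρ) : rhoInner ρ a b = rhoInner ρ a' b' := by
  have h1 : rhoInner ρ a b = rhoInner ρ a b' := by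
    rw [← sub_add_cancel b b', rhoInner_add_right, rhoInner_of_mem_radical a hb, zero_add]
  have h2 : rhoInner ρ a b' = rhoInner ρ a' b' := by
    rw [← sub_add_cancel a a', rhoInner_add_left, ← hρ.conj_rhoInner, rhoInner_of_mem_radical b' ha,
      map_zero, zero_add]
  rw [h1, h2]

open scoped ComplexOrder in
theorem Matrix.PosSemidef.rhoInner_self_re_nonneg {ρ : Matrix Λ Λ ℂ} (hρ : ρ.PosSemidef)
    (a : Λ →₀ ℂ) : 0 ≤ (rhoInner ρ a a).re := by
  have h : 0 ≤ rhoInner ρ a a := hρ.2 a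
  exact (Complex.le_def.1 h).1

open scoped ComplexOrder in
theorem Matrix.PosSemidef.rhoInner_self_re_pos {ρ : Matrix Λ Λ ℂ} (hρ : ρ.PosSemidef)
    {a : Λ →₀ ℂ} (ha : a ∉ radical ρ) : 0 < (rhoInner ρ a a).re := by
  refine (hρ.rhoInner_self_re_nonneg a).lt_of_ne fun h0 => ha ?_
  rw [mem_radical_iff hρ]
  exact Complex.ext h0.symm (Complex.conj_eq_iff_im.1 (hρ.1.conj_rhoInner a a))

/-! ### Transport of Hermitian forms along linear maps from and to `c_c(Λ)` -/

section Pullback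

variable {V : Type v} [AddCommGroup V] [Module ℂ V]

/-- The pullback of a Hermitian form by a linear map into `c_c(Λ)`. -/
def rhoPullback (ρ : Matrix Λ Λ ℂ) (hρ : ρ.IsHermitian) (s : V →ₗ[ℂ] (Λ →₀ ℂ)) : HermForm V :=
  ⟨LinearMap.mk₂'ₛₗ (starRingEnd ℂ) (RingHom.id ℂ) (fun x y => rhoInner ρ (s x) (s y))
    (fun x x' y => by rw [map_add, rhoInner_add_left])
    (fun c x y => by rw [map_smul, rhoInner_smul_left]; rfl)
    (fun x y y' => by rw [map_add, rhoInner_add_right])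
    (fun c x y => by rw [map_smul, rhoInner_smul_right]; rfl),
    fun x y => (hρ.conj_rhoInner (s x) (s y)).symm⟩

open scoped ComplexOrder in
theorem rhoPullback_mem_posCone {ρ : Matrix Λ Λ ℂ} (hρ : ρ.PosSemidef) {s : V →ₗ[ℂ] (Λ →₀ ℂ)}
    (hs : ∀ x, s x ∈ radical ρ → x = 0) : rhoPullback ρ hρ.1 s ∈ posCone V := by
  rw [mem_posCone_iff]
  exact fun x hx => hρ.rhoInner_self_re_pos fun h => hx (hs x h)

/-- The matrix of the pullback of a Hermitian form by a linear map defined on `c_c(Λ)`. -/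
def pullbackMatrix (c : (Λ →₀ ℂ) →ₗ[ℂ] V) (h : HermForm V) : Matrix Λ Λ ℂ :=
  Matrix.of fun l k => h.1 (c (Finsupp.single l 1)) (c (Finsupp.single k 1))

theorem rhoInner_pullbackMatrix (c : (Λ →₀ ℂ) →ₗ[ℂ] V) (h : HermForm V) (a b : Λ →₀ ℂ) :
    rhoInner (pullbackMatrix c h) a b = h.1 (c a) (c b) :=
  rhoInner_of_sesq (LinearMap.mk₂'ₛₗ (starRingEnd ℂ) (RingHom.id ℂ) (fun x y => h.1 (c x) (c y))
    (fun x x' y => by simp) (fun e x y => by simp [LinearMap.map_smulₛₗ])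
    (fun x y y' => by simp) (fun e x y => by simp)) a b

open scoped ComplexOrder in
theorem posSemidef_pullbackMatrix (c : (Λ →₀ ℂ) →ₗ[ℂ] V) {h : HermForm V} (hh : h ∈ posCone V) :
    (pullbackMatrix c h).PosSemidef := by
  refine ⟨Matrix.IsHermitian.ext fun l k => HermForm.conj_apply h _ _, fun a => ?_⟩
  change 0 ≤ rhoInner (pullbackMatrix c h) a a
  rw [rhoInner_pullbackMatrix, Complex.le_def]
  exact ⟨hh.1 _, (HermForm.apply_self_im h _).symm⟩

/-- The radical consists of the vectors `a` of length zero, and `h(c a, c a) = 0` forces `c a = 0`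
as `h` is definite. -/
theorem radical_pullbackMatrix (c : (Λ →₀ ℂ) →ₗ[ℂ] V) {h : HermForm V} (hh : h ∈ posCone V) :
    radical (pullbackMatrix c h) = LinearMap.ker c := by
  ext a
  rw [mem_radical_iff (posSemidef_pullbackMatrix c hh), rhoInner_pullbackMatrix, LinearMap.mem_ker]
  constructor
  · intro h0
    by_contra hc
    have h1 := mem_posCone_iff.1 hh _ hc
    rw [h0] at h1
    exact lt_irrefl _ h1
  · intro h0
    simp [h0]

/-- The positive Hermitian form on `c_c(Λ)` given by a form on the quotient by `K`. -/
def HForm.ofForm (K : Gr m Λ) (c : (Λ →₀ ℂ) →ₗ[ℂ] V) (hc : LinearMap.ker c = K.1)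
    (h : posCone V) : HForm m Λ :=
  ⟨pullbackMatrix c h.1, posSemidef_pullbackMatrix c h.2, by
    rw [radical_pullbackMatrix c h.2, hc]
    exact K.2⟩

theorem HForm.j_ofForm (K : Gr m Λ) (c : (Λ →₀ ℂ) →ₗ[ℂ] V) (hc : LinearMap.ker c = K.1)
    (h : posCone V) : (HForm.ofForm K c hc h).j = K :=
  Subtype.ext ((radical_pullbackMatrix c h.2).trans hc)

end Pullback

theorem HForm.ext_apply {ρ σ : HForm m Λ} (h : ∀ l k, ρ.1 l k = σ.1 l k) : ρ = σ :=
  Subtype.ext (Matrix.ext h)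

theorem HForm.isEmbedding_val : IsEmbedding (fun ρ : HForm m Λ => (ρ.1 : Matrix Λ Λ ℂ)) :=
  ⟨⟨rfl⟩, Subtype.val_injective⟩

theorem HForm.continuous_val : Continuous (fun ρ : HForm m Λ => (ρ.1 : Matrix Λ Λ ℂ)) :=
  HForm.isEmbedding_val.continuous

instance HForm.t2Space : T2Space (HForm m Λ) :=
  have : T2Space (Matrix Λ Λ ℂ) := inferInstanceAs (T2Space (Λ → Λ → ℂ))
  HForm.isEmbedding_val.t2Space

theorem continuous_rhoInner (a b : Λ →₀ ℂ) :
    Continuous fun ρ : Matrix Λ Λ ℂ => rhoInner ρ a b := by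
  simp only [rhoInner_eq_sum]
  exact continuous_finsetSum _ fun l _ => continuous_finsetSum _ fun k _ =>
    (continuous_const.mul (continuous_id.matrix_elem l k)).mul continuous_const

theorem HForm.continuous_rhoInner (a b : Λ →₀ ℂ) :
    Continuous fun ρ : HForm m Λ => rhoInner ρ.1 a b :=
  (_root_.continuous_rhoInner a b).comp HForm.continuous_val

/-- A linear section of the quotient map. -/
theorem Gr.exists_section (J : Gr m Λ) : ∃ s : quotFiber m Λ J →ₗ[ℂ] (Λ →₀ ℂ),
    ∀ x, Submodule.Quotient.mk (s x) = x := by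
  obtain ⟨s, hs⟩ := J.1.mkQ.exists_rightInverse_of_surjective J.1.range_mkQ
  exact ⟨s, fun x => LinearMap.congr_fun hs x⟩

theorem Gr.section_mk_sub_mem (J : Gr m Λ) (a : Λ →₀ ℂ) :
    a - J.exists_section.choose (Submodule.Quotient.mk a) ∈ J.1 := by
  rw [← Submodule.Quotient.eq, J.exists_section.choose_spec]

/-- The homeomorphism from the fiber of `j` over `J` onto the cone of non-degenerate positive
Hermitian forms on the quotient by `J`. -/
def fiberHomeomorph (J : Gr m Λ) :
    {ρ : HForm m Λ // ρ.j = J} ≃ₜ posCone (quotFiber m Λ J) where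
  -- The form on the quotient is computed on a linear section; the choice is immaterial because `J`
  -- is the radical of `ρ`.
  toFun ρ := ⟨rhoPullback ρ.1.1 ρ.1.2.1.1 J.exists_section.choose,
    rhoPullback_mem_posCone ρ.1.2.1 fun x hx => by
      have h : J.exists_section.choose x ∈ J.1 := (congr_arg Subtype.val ρ.2).le hx
      rw [← J.exists_section.choose_spec x, (Submodule.Quotient.mk_eq_zero _).2 h]⟩
  invFun h := ⟨HForm.ofForm J J.1.mkQ J.1.ker_mkQ h, HForm.j_ofForm _ _ _ _⟩
  left_inv ρ := by
    refine Subtype.ext (HForm.ext_apply fun l k => ?_)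
    have hJ : radical ρ.1.1 = J.1 := congr_arg Subtype.val ρ.2
    rw [← rhoInner_single ρ.1.1 l k]
    refine (rhoInner_congr ρ.1.2.1.1 ?_ ?_).symm <;> rw [hJ] <;> exact J.section_mk_sub_mem _
  right_inv h := by
    refine Subtype.ext (HermForm.ext_apply fun x y => ?_)
    refine (rhoInner_pullbackMatrix J.1.mkQ h.1 _ _).trans ?_
    rw [Submodule.mkQ_apply, Submodule.mkQ_apply, J.exists_section.choose_spec,
      J.exists_section.choose_spec]
  continuous_toFun := by
    refine Continuous.subtype_mk (HermForm.continuous_rng fun x y => ?_) _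
    exact (HForm.continuous_rhoInner _ _).comp continuous_subtype_val
  continuous_invFun := by
    refine Continuous.subtype_mk (continuous_induced_rng.2 (continuous_matrix fun l k => ?_)) _
    exact (HermForm.continuous_apply _ _).comp continuous_subtype_val

theorem fiberHomeomorph_apply (J : Gr m Λ) (ρ : {ρ : HForm m Λ // ρ.j = J}) (a b : Λ →₀ ℂ) :
    (fiberHomeomorph J ρ).1.1 (Submodule.Quotient.mk a) (Submodule.Quotient.mk b) =
      rhoInner ρ.1.1 a b := by
  have hJ : radical ρ.1.1 = J.1 := congr_arg Subtype.val ρ.2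
  refine (rhoInner_congr ρ.1.2.1.1 ?_ ?_).symm <;> rw [hJ] <;> exact J.section_mk_sub_mem _

end PositiveForms

/-! ### The fibration of the space of Hermitian forms over the Grassmannian -/

section Fibration

open Matrix

variable {Λ : Type u} {m : ℕ}

/-- The pairings of the vectors `v` with the standard basis. -/
def rowMat (M : Matrix Λ Λ ℂ) (v : Fin m → Λ →₀ ℂ) : Matrix (Fin m) Λ ℂ :=
  Matrix.of fun i l => rhoInner M (v i) (Finsupp.single l 1)

/-- The Gram matrix of the vectors `v`. -/
def gramMat (M : Matrix Λ Λ ℂ) (v : Fin m → Λ →₀ ℂ) : Matrix (Fin m) (Fin m) ℂ :=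
  Matrix.of fun i j => rhoInner M (v i) (v j)

theorem ev_rowMat (M : Matrix Λ Λ ℂ) (v : Fin m → Λ →₀ ℂ) (a : Λ →₀ ℂ) (i : Fin m) :
    ev (rowMat M v) a i = rhoInner M (v i) a := by
  have h : Finsupp.linearCombination ℂ (rowMat M v i) = rhoForm M (v i) := by
    ext l
    simp [rowMat, rhoForm_apply]
  exact LinearMap.congr_fun h a

theorem pair_rowMat (M : Matrix Λ Λ ℂ) (v : Fin m → Λ →₀ ℂ) : pair (rowMat M v) v = gramMat M v := by
  ext i j
  rw [pair_apply, ev_rowMat]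
  rfl

/-- The linear map which sends `x` to `∑ x_i v_i`. -/
abbrev combine (v : Fin m → Λ →₀ ℂ) : (Fin m → ℂ) →ₗ[ℂ] (Λ →₀ ℂ) := Fintype.linearCombination ℂ v

theorem combine_apply (v : Fin m → Λ →₀ ℂ) (x : Fin m → ℂ) : combine v x = ∑ i, x i • v i :=
  Fintype.linearCombination_apply ℂ v x

theorem ev_combine {A : Matrix (Fin m) Λ ℂ} {v : Fin m → Λ →₀ ℂ} (h : pair A v = 1)
    (x : Fin m → ℂ) : ev A (combine v x) = x := by
  rw [combine_apply, ev_sum_smul, h, one_mulVec]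

theorem gramMat_mulVec_apply (M : Matrix Λ Λ ℂ) (v : Fin m → Λ →₀ ℂ) (x : Fin m → ℂ) (i : Fin m) :
    (gramMat M v *ᵥ x) i = rhoInner M (v i) (combine v x) := by
  rw [← pair_rowMat, ← ev_sum_smul, ev_rowMat, combine_apply]

theorem HForm.mem_j_iff {ρ : HForm m Λ} {a : Λ →₀ ℂ} : a ∈ ρ.j.1 ↔ a ∈ radical ρ.1 := Iff.rfl

/-- A combination of the `v_i` which is orthogonal to every `v_i` is orthogonal to itself, so by
positivity it is in the radical. -/
theorem HForm.combine_mem_radical_iff (ρ : HForm m Λ) (v : Fin m → Λ →₀ ℂ) (x : Fin m → ℂ) :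
    combine v x ∈ radical ρ.1 ↔ gramMat ρ.1 v *ᵥ x = 0 := by
  constructor
  · intro h
    funext i
    rw [gramMat_mulVec_apply, rhoInner_of_mem_radical _ h]
    rfl
  · intro h
    rw [mem_radical_iff ρ.2.1, ← rhoForm_apply]
    nth_rewrite 1 [combine_apply]
    rw [map_sum (rhoForm ρ.1), LinearMap.sum_apply]
    refine Finset.sum_eq_zero fun i _ => ?_
    rw [LinearMap.map_smulₛₗ (rhoForm ρ.1), LinearMap.smul_apply, rhoForm_apply,
      ← gramMat_mulVec_apply, h]
    simp

/-- The radical is a supplement of the span of `v` if and only if the Gram matrix of `v` is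
invertible. -/
theorem HForm.j_mem_chartDomain_iff {ρ : HForm m Λ} {v : Fin m → Λ →₀ ℂ} :
    ρ.j ∈ chartDomain (Submodule.span ℂ (range v)) ↔ (gramMat ρ.1 v).det ≠ 0 := by
  obtain ⟨A, hA⟩ := ρ.j.exists_represents
  -- Both determinants vanish exactly when `∑ x_i v_i` lies in the radical for some nonzero `x`.
  rw [hA.mem_chartDomain_iff, not_iff_not, ← Matrix.exists_mulVec_eq_zero_iff,
    ← Matrix.exists_mulVec_eq_zero_iff]
  refine exists_congr fun x => and_congr_right fun _ => ?_
  rw [← ρ.combine_mem_radical_iff, ← HForm.mem_j_iff, hA.mem_iff, combine_apply, ev_sum_smul]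

/-- The rows vanish on `J_ρ`, so this matrix is the Gram matrix times the normalized matrix of
`J_ρ`, and the Gram matrix is invertible on `U_v`. -/
theorem HForm.represents_rowMat {ρ : HForm m Λ} {v : Fin m → Λ →₀ ℂ}
    (h : ρ.j ∈ chartDomain (Submodule.span ℂ (range v))) : Represents (rowMat ρ.1 v) ρ.j := by
  have hN := ρ.j.represents_frameMat v
  rw [eq_pair_mul_of_ker_le (A := ρ.j.frameMat v) (A' := rowMat ρ.1 v) (Gr.pair_frameMat h),
    pair_rowMat]
  · exact hN.mul (HForm.j_mem_chartDomain_iff.1 h)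
  · intro a ha
    funext i
    rw [ev_rowMat, rhoInner_of_mem_radical _ (hN.mem_iff.2 ha)]
    rfl

theorem HForm.frameMat_j {ρ : HForm m Λ} {v : Fin m → Λ →₀ ℂ}
    (h : ρ.j ∈ chartDomain (Submodule.span ℂ (range v))) :
    ρ.j.frameMat v = (gramMat ρ.1 v)⁻¹ * rowMat ρ.1 v := by
  rw [(HForm.represents_rowMat h).frameMat_eq h, pair_rowMat]

theorem HForm.isOpen_preimage_chartDomain (v : Fin m → Λ →₀ ℂ) :
    IsOpen (HForm.j ⁻¹' chartDomain (Submodule.span ℂ (range v)) : Set (HForm m Λ)) := by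
  have h : (HForm.j ⁻¹' chartDomain (Submodule.span ℂ (range v)) : Set (HForm m Λ)) =
      {ρ | (gramMat ρ.1 v).det ≠ 0} := ext fun ρ => HForm.j_mem_chartDomain_iff
  rw [h]
  refine isOpen_ne_fun (Continuous.matrix_det ?_) continuous_const
  exact continuous_matrix fun i j => HForm.continuous_rhoInner _ _

theorem HForm.continuousOn_j (v : Fin m → Λ →₀ ℂ) :
    ContinuousOn (HForm.j : HForm m Λ → Gr m Λ)
      (HForm.j ⁻¹' chartDomain (Submodule.span ℂ (range v))) :=
  Gr.continuousOn_of_represents (A := fun ρ : HForm m Λ => rowMat ρ.1 v)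
    (fun _ _ => (HForm.continuous_rhoInner _ _).continuousOn) fun _ hρ => HForm.represents_rowMat hρ

/-- The form induced on `ℂ^m` by the family `v`. -/
def HForm.gramForm (ρ : HForm m Λ) (v : Fin m → Λ →₀ ℂ) : HermForm (Fin m → ℂ) :=
  rhoPullback ρ.1 ρ.2.1.1 (combine v)

theorem HForm.gramForm_apply (ρ : HForm m Λ) (v : Fin m → Λ →₀ ℂ) (x y : Fin m → ℂ) :
    (ρ.gramForm v).1 x y = rhoInner ρ.1 (combine v x) (combine v y) := rfl

theorem HForm.gramForm_mem {ρ : HForm m Λ} {v : Fin m → Λ →₀ ℂ}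
    (h : ρ.j ∈ chartDomain (Submodule.span ℂ (range v))) :
    ρ.gramForm v ∈ posCone (Fin m → ℂ) := by
  refine rhoPullback_mem_posCone ρ.2.1 fun x hx => ?_
  rw [← ev_combine (Gr.pair_frameMat h) x, ← (ρ.j.represents_frameMat v).mem_iff]
  exact hx

open Classical in
/-- The form induced on `ℂ^m` by the family `v`, as an element of the cone. -/
def HForm.coneForm (ρ : HForm m Λ) (v : Fin m → Λ →₀ ℂ) : posCone (Fin m → ℂ) :=
  -- A trivialization is a total function, so some point of the cone has to be supplied as a default
  -- value.
  if h : ρ.gramForm v ∈ posCone (Fin m → ℂ) then ⟨_, h⟩ else ⟨_, (nonempty_posCone m).choose_spec⟩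

theorem HForm.coe_coneForm {ρ : HForm m Λ} {v : Fin m → Λ →₀ ℂ}
    (h : ρ.j ∈ chartDomain (Submodule.span ℂ (range v))) :
    (ρ.coneForm v : HermForm (Fin m → ℂ)) = ρ.gramForm v := by
  rw [HForm.coneForm, dif_pos (HForm.gramForm_mem h)]

/-- The subtracted vector is the projection of `a` onto the span of `v` along `K`. -/
theorem sub_combine_mem {K : Gr m Λ} {v : Fin m → Λ →₀ ℂ}
    (h : K ∈ chartDomain (Submodule.span ℂ (range v))) (a : Λ →₀ ℂ) :
    a - combine v (ev (K.frameMat v) a) ∈ K.1 := by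
  rw [(K.represents_frameMat v).mem_iff, map_sub, ev_combine (Gr.pair_frameMat h), sub_self]

/-- The form on `c_c(Λ)` with radical `K` and a given Gram matrix of the family `v`. -/
def HForm.ofFrame (v : Fin m → Λ →₀ ℂ) (p : Gr m Λ × posCone (Fin m → ℂ)) : HForm m Λ :=
  HForm.ofForm p.1 (ev (p.1.frameMat v)) (p.1.represents_frameMat v) p.2

theorem HForm.j_ofFrame (v : Fin m → Λ →₀ ℂ) (p : Gr m Λ × posCone (Fin m → ℂ)) :
    (HForm.ofFrame v p).j = p.1 := HForm.j_ofForm _ _ _ _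

/-- This is `ρ = N* h N` with `N` the normalized matrix; each entry involves only two columns of
`N`. -/
theorem HForm.ofFrame_apply (v : Fin m → Λ →₀ ℂ) (p : Gr m Λ × posCone (Fin m → ℂ)) (l k : Λ) :
    (HForm.ofFrame v p).1 l k = ∑ i, ∑ j, conj (p.1.frameMat v i l) *
      p.2.1.1 (Pi.single i 1) (Pi.single j 1) * p.1.frameMat v j k := by
  refine (HermForm.apply_eq_sum (Pi.basisFun ℂ (Fin m)) p.2.1 _ _).trans ?_
  simp only [Pi.basisFun_repr, Pi.basisFun_apply, ev_single]

/-- The trivialization of `j` given by the family `v`. -/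
def frameTrivialization (v : Fin m → Λ →₀ ℂ) :
    Trivialization (posCone (Fin m → ℂ)) (HForm.j : HForm m Λ → Gr m Λ) where
  toFun ρ := (ρ.j, ρ.coneForm v)
  invFun p := HForm.ofFrame v p
  source := HForm.j ⁻¹' chartDomain (Submodule.span ℂ (range v))
  target := chartDomain (Submodule.span ℂ (range v)) ×ˢ univ
  map_source' ρ hρ := ⟨hρ, trivial⟩
  map_target' p hp := by
    rw [mem_preimage, HForm.j_ofFrame]
    exact hp.1
  left_inv' ρ hρ := by
    refine HForm.ext_apply fun l k => ?_
    refine Eq.trans (b := (ρ.coneForm v).1.1 (ev (ρ.j.frameMat v) (Finsupp.single l 1))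
      (ev (ρ.j.frameMat v) (Finsupp.single k 1))) rfl ?_
    rw [HForm.coe_coneForm hρ, HForm.gramForm_apply, ← rhoInner_single ρ.1 l k]
    -- Replacing basis vectors by their projections onto the span of `v` changes them by elements of
    -- the radical only.
    exact (rhoInner_congr ρ.2.1.1 (sub_combine_mem hρ _) (sub_combine_mem hρ _)).symm
  right_inv' p hp := by
    have hj := HForm.j_ofFrame v p
    refine Prod.ext hj (Subtype.ext (HermForm.ext_apply fun x y => ?_))
    have hp' : (HForm.ofFrame v p).j ∈ chartDomain (Submodule.span ℂ (range v)) := by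
      rw [hj]
      exact hp.1
    rw [HForm.coe_coneForm hp', HForm.gramForm_apply]
    refine (rhoInner_pullbackMatrix _ p.2.1 _ _).trans ?_
    rw [ev_combine (Gr.pair_frameMat hp.1), ev_combine (Gr.pair_frameMat hp.1)]
  open_source := HForm.isOpen_preimage_chartDomain v
  open_target := (isOpen_chartDomain_span v).prod isOpen_univ
  continuousOn_toFun := by
    refine (HForm.continuousOn_j v).prodMk ?_
    refine Topology.IsInducing.subtypeVal.continuousOn_iff.2 ?_
    have h : Continuous fun ρ : HForm m Λ => ρ.gramForm v :=
      HermForm.continuous_rng fun x y => HForm.continuous_rhoInner _ _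
    exact h.continuousOn.congr fun ρ hρ => HForm.coe_coneForm hρ
  continuousOn_invFun := by
    refine HForm.isEmbedding_val.continuousOn_iff.2 ?_
    refine continuousOn_pi.2 fun l => continuousOn_pi.2 fun k => ?_
    simp only [Function.comp_def, HForm.ofFrame_apply]
    have hN : ∀ i l, ContinuousOn (fun p : Gr m Λ × posCone (Fin m → ℂ) => p.1.frameMat v i l)
        (chartDomain (Submodule.span ℂ (range v)) ×ˢ univ) := fun i l =>
      (Gr.continuousOn_frameMat v i l).comp continuousOn_fst fun p hp => hp.1
    refine continuousOn_finsetSum _ fun i _ => continuousOn_finsetSum _ fun j _ => ?_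
    refine ((Complex.continuous_conj.comp_continuousOn (hN i l)).mul ?_).mul (hN j k)
    exact ((HermForm.continuous_apply _ _).comp
      (continuous_subtype_val.comp continuous_snd)).continuousOn
  baseSet := chartDomain (Submodule.span ℂ (range v))
  open_baseSet := isOpen_chartDomain_span v
  source_eq := rfl
  target_eq := rfl
  proj_toFun _ _ := rfl

variable (m) in
/-- The inclusion of the cone in the space of Hermitian forms, as a chart. -/
def coneChart : OpenPartialHomeomorph (posCone (Fin m → ℂ)) (HermForm (Fin m → ℂ)) :=
  have : Nonempty (posCone (Fin m → ℂ)) := (nonempty_posCone m).to_subtype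
  (isOpen_posCone (Pi.basisFun ℂ (Fin m))).isOpenEmbedding_subtypeVal.toOpenPartialHomeomorph _

theorem coneChart_apply (h : posCone (Fin m → ℂ)) : coneChart m h = h.1 := rfl

theorem coneChart_source : (coneChart m).source = univ := rfl

theorem coneChart_target : (coneChart m).target = posCone (Fin m → ℂ) := by
  have h : (coneChart m).target = Subtype.val '' univ := rfl
  rw [h, image_univ, Subtype.range_coe]

theorem coe_coneChart_symm {h : HermForm (Fin m → ℂ)} (hh : h ∈ posCone (Fin m → ℂ)) :
    ((coneChart m).symm h : HermForm (Fin m → ℂ)) = h :=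
  (coneChart m).right_inv (coneChart_target.symm.le hh)

variable (m) in
/-- The coordinates on the Hermitian forms on `ℂ^m`. -/
abbrev hermCoords : Coords (HermForm (Fin m → ℂ)) (Fin m × Fin m) :=
  HermForm.coords (Pi.basisFun ℂ (Fin m))

instance : IsTopologicalAddGroup (HermForm (Fin m → ℂ)) := (hermCoords m).isTopologicalAddGroup

instance : ContinuousSMul ℝ (HermForm (Fin m → ℂ)) := (hermCoords m).continuousSMul

/-- The product of a chart of the Grassmannian and the chart of the cone. -/
abbrev baseChart (p : ChartIdx m Λ) :
    OpenPartialHomeomorph (Gr m Λ × posCone (Fin m → ℂ)) (p.Model × HermForm (Fin m → ℂ)) :=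
  (grChart p).prod (coneChart m)

/-- The chart of the space of Hermitian forms given by a frame. -/
def formChart (q : FrameIdx m Λ) :
    OpenPartialHomeomorph (HForm m Λ) (q.toChartIdx.Model × HermForm (Fin m → ℂ)) :=
  (frameTrivialization q.v).toOpenPartialHomeomorph.trans (baseChart q.toChartIdx)

/-- The expression of a trivialization in charts, extended to an open set of matrices. -/
def chartFun (p : ChartIdx m Λ) (v : Fin m → Λ →₀ ℂ) (M : Matrix Λ Λ ℂ) :
    p.Model × HermForm (Fin m → ℂ) :=
  (p.ofMat ((gramMat M p.frame)⁻¹ * rowMat M p.frame - p.base),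
    HermForm.ofMatrix (Pi.basisFun ℂ (Fin m)) fun ij => gramMat M v ij.1 ij.2)

/-- The first component uses the Gram matrix of the frame of `p`, the second that of `v`: the two
families are independent of each other. -/
theorem baseChart_frameTrivialization {p : ChartIdx m Λ} {v : Fin m → Λ →₀ ℂ} {ρ : HForm m Λ}
    (hv : ρ.j ∈ chartDomain (Submodule.span ℂ (range v))) (hp : ρ.j ∈ (grChart p).source) :
    baseChart p (frameTrivialization v ρ) = chartFun p v ρ.1 := by
  refine Prod.ext ?_ ?_
  · change grChart p ρ.j = _
    rw [grChart_apply, HForm.frameMat_j (mem_grChart_source.1 hp)]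
    rfl
  · change (ρ.coneForm v : HermForm (Fin m → ℂ)) = _
    rw [HForm.coe_coneForm hv,
      ← HermForm.ofMatrix_coords (Pi.basisFun ℂ (Fin m)) (ρ.gramForm v)]
    refine congr_arg (HermForm.ofMatrix _) (funext fun ⟨i, j⟩ => ?_)
    rw [HermForm.coords_apply, HForm.gramForm_apply, Pi.basisFun_apply, Pi.basisFun_apply]
    simp [gramMat]

/-! ### Smoothness of the trivializations, expressed in charts -/

section Smooth

variable {D : Type v} [AddCommGroup D] [Module ℝ D] [TopologicalSpace D] {U : Set D}

theorem CylSmoothOn.rhoInner {M : D → Matrix Λ Λ ℂ}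
    (hM : ∀ l k, CylSmoothOn (fun x => M x l k) U) (a b : Λ →₀ ℂ) :
    CylSmoothOn (fun x => rhoInner (M x) a b) U := by
  simp only [rhoInner_eq_sum]
  exact CylSmoothOn.sum _ fun l _ => CylSmoothOn.sum _ fun k _ =>
    ((CylSmoothOn.const _).mul (hM l k)).mul (CylSmoothOn.const _)

theorem CylSmoothOn.ofFrame {κ : D → Gr m Λ} {h : D → posCone (Fin m → ℂ)}
    {A : D → Matrix (Fin m) Λ ℂ} (hA : ∀ i l, CylSmoothOn (fun x => A x i l) U)
    (hκ : ∀ x ∈ U, Represents (A x) (κ x)) {v : Fin m → Λ →₀ ℂ}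
    (hv : ∀ x ∈ U, κ x ∈ chartDomain (Submodule.span ℂ (range v)))
    (hh : ∀ y z, CylSmoothOn (fun x => (h x).1.1 y z) U) (l k : Λ) :
    CylSmoothOn (fun x => (HForm.ofFrame v (κ x, h x)).1 l k) U := by
  simp only [HForm.ofFrame_apply]
  have hN := CylSmoothOn.frameMat hA hκ hv
  exact CylSmoothOn.sum _ fun i _ => CylSmoothOn.sum _ fun j _ =>
    ((hN i l).conjugate.mul (hh _ _)).mul (hN j k)

/-- In charts, the inverse of a trivialization has smooth matrix entries. -/
theorem cylSmoothOn_frameTrivialization_symm (p : ChartIdx m Λ) (v : Fin m → Λ →₀ ℂ)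
    {U : Set (p.Model × HermForm (Fin m → ℂ))} (hU : U ⊆ (baseChart p).target)
    (hv : ∀ t ∈ U, (grChart p).symm t.1 ∈ chartDomain (Submodule.span ℂ (range v))) (l k : Λ) :
    CylSmoothOn (fun t => ((frameTrivialization v).toOpenPartialHomeomorph.symm
      ((baseChart p).symm t)).1 l k) U := by
  refine CylSmoothOn.ofFrame (κ := fun t : p.Model × HermForm (Fin m → ℂ) => (grChart p).symm t.1)
    (h := fun t : p.Model × HermForm (Fin m → ℂ) => (coneChart m).symm t.2)
    (A := fun t => p.base + t.1.mat) (fun i l => ?_) (fun t _ => represents_grChart_symm p t.1) hv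
    (fun y z => ?_) l k
  · exact (CylSmoothOn.const _).add ((p.coords.prod (hermCoords m)).cylSmoothOn (Sum.inl (i, l)) U)
  · refine CylSmoothOn.congr (f := fun t => ∑ i, ∑ j, conj (y i) *
      (p.coords.prod (hermCoords m)).toFun t (Sum.inr (i, j)) * z j) ?_ fun t ht => ?_
    · exact CylSmoothOn.sum _ fun i _ => CylSmoothOn.sum _ fun j _ =>
        ((CylSmoothOn.const _).mul (Coords.cylSmoothOn _ _ U)).mul (CylSmoothOn.const _)
    · have ht2 : t.2 ∈ posCone (Fin m → ℂ) := coneChart_target.le (hU ht).2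
      simp only [coe_coneChart_symm ht2]
      exact HermForm.apply_eq_sum (Pi.basisFun ℂ (Fin m)) t.2 y z

variable [ContinuousAdd D] [ContinuousSMul ℝ D]

/-- The matrices need be neither Hermitian nor positive. This serves both for families of forms and
for extending the charts to open sets of `ℂ^{Λ×Λ}`. -/
theorem smoothOn_chartFun (p : ChartIdx m Λ) (v : Fin m → Λ →₀ ℂ) (hU : IsOpen U)
    {M : D → Matrix Λ Λ ℂ} (hM : ∀ l k, CylSmoothOn (fun x => M x l k) U)
    (h0 : ∀ x ∈ U, (gramMat (M x) p.frame).det ≠ 0) :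
    SmoothOn (fun x => chartFun p v (M x)) U := by
  refine (p.coords.prod (hermCoords m)).smoothOn hU ?_
  rintro (⟨i, l⟩ | ⟨i, j⟩)
  · refine CylSmoothOn.congr (f := fun x =>
      ((gramMat (M x) p.frame)⁻¹ * rowMat (M x) p.frame) i l - p.base i l) ?_ fun x hx => ?_
    · refine CylSmoothOn.sub ?_ (CylSmoothOn.const _)
      exact CylSmoothOn.matrix_mul
        (CylSmoothOn.matrix_inv (fun _ _ => CylSmoothOn.rhoInner hM _ _) h0)
        (fun _ _ => CylSmoothOn.rhoInner hM _ _) i l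
    · change (p.ofMat _).mat i l = _
      -- The matrix is a difference of two matrices dual to the frame, so its rows lie in `J'^⊥` and
      -- the retraction leaves it unchanged.
      rw [p.mat_ofMat]
      · rfl
      · rw [pair_sub, pair_mul, pair_rowMat, p.pair_base,
          Matrix.nonsing_inv_mul _ (isUnit_iff_ne_zero.2 (h0 x hx)), sub_self]
  · refine CylSmoothOn.congr (f := fun x =>
      (gramMat (M x) v i j + conj (gramMat (M x) v j i)) * 2⁻¹) ?_ fun x _ => ?_
    · exact ((CylSmoothOn.rhoInner hM _ _).add (CylSmoothOn.rhoInner hM _ _).conjugate).mul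
        (CylSmoothOn.const _)
    · change (hermCoords m).toFun (HermForm.ofMatrix _ _) (i, j) = _
      rw [HermForm.coords_ofMatrix, hermPart, div_eq_mul_inv]

/-- In charts, a trivialization is smooth on families of forms with smooth matrix entries. -/
theorem smoothOn_baseChart_frameTrivialization (p : ChartIdx m Λ) (v : Fin m → Λ →₀ ℂ)
    (hU : IsOpen U) {σ : D → HForm m Λ} (hσ : ∀ l k, CylSmoothOn (fun x => (σ x).1 l k) U)
    (hv : ∀ x ∈ U, (σ x).j ∈ chartDomain (Submodule.span ℂ (range v)))
    (hp : ∀ x ∈ U, (σ x).j ∈ (grChart p).source) :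
    SmoothOn (fun x => baseChart p (frameTrivialization v (σ x))) U :=
  (smoothOn_chartFun p v hU hσ fun x hx =>
    HForm.j_mem_chartDomain_iff.1 (mem_grChart_source.1 (hp x hx))).congr hU fun x hx =>
      baseChart_frameTrivialization (hv x hx) (hp x hx)

/-- The domain of the trivialization and that of the Grassmannian chart impose the same condition,
as both depend only on the span of `q.v`; the chart of the cone imposes none. -/
theorem mem_formChart_source {q : FrameIdx m Λ} {ρ : HForm m Λ} :
    ρ ∈ (formChart q).source ↔ ρ.j ∈ chartDomain (Submodule.span ℂ (range q.v)) :=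
  ⟨fun h => h.1, fun h => ⟨h, h, trivial⟩⟩

theorem smoothOn_formChart (q : FrameIdx m Λ) (hU : IsOpen U) {σ : D → HForm m Λ}
    (hσ : ∀ l k, CylSmoothOn (fun x => (σ x).1 l k) U)
    (hq : ∀ x ∈ U, σ x ∈ (formChart q).source) : SmoothOn (fun x => formChart q (σ x)) U :=
  smoothOn_baseChart_frameTrivialization q.toChartIdx q.v hU hσ
    (fun x hx => mem_formChart_source.1 (hq x hx)) fun x hx => mem_formChart_source.1 (hq x hx)

end Smooth

/-! ### The Fréchet manifold of positive forms and its fibration -/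

theorem cylSmoothOn_formChart_symm (q : FrameIdx m Λ)
    {U : Set (q.toChartIdx.Model × HermForm (Fin m → ℂ))} (hU : U ⊆ (formChart q).target)
    (l k : Λ) : CylSmoothOn (fun t => ((formChart q).symm t).1 l k) U :=
  cylSmoothOn_frameTrivialization_symm q.toChartIdx q.v (fun _ ht => (hU ht).1)
    (fun _ ht => (hU ht).2.1) l k

theorem isFrechetManifold_formChart [Countable Λ] :
    IsFrechetManifold (fun q : FrameIdx m Λ => formChart q) where
  t2 := inferInstance
  frechet q := (q.toChartIdx.coords.prod (hermCoords m)).isFrechetSpace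
  cover ρ := by
    obtain ⟨v, hv, hK, hc⟩ := ρ.j.exists_mem_chartDomain
    exact ⟨⟨ρ.j, v, hv, hc⟩, mem_formChart_source.2 hK⟩
  smooth_transition q q' :=
    smoothOn_formChart q' ((formChart q).isOpen_inter_preimage_symm (formChart q').open_source)
      (cylSmoothOn_formChart_symm q inter_subset_left) fun _ ht => ht.2

theorem isFrechetManifold_coneChart : IsFrechetManifold (fun _ : Unit => coneChart m) where
  t2 := by
    have := (hermCoords m).t2
    infer_instance
  frechet _ := (hermCoords m).isFrechetSpace
  cover h := ⟨(), trivial⟩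
  smooth_transition _ _ := by
    have hU := (coneChart m).isOpen_inter_preimage_symm (coneChart m).open_source
    refine (hermCoords m).smoothOn hU fun ij => ?_
    exact ((hermCoords m).cylSmoothOn ij _).congr fun t ht =>
      congr_arg (fun h => (hermCoords m).toFun h ij) ((coneChart m).right_inv ht.1)

variable (Λ) in
/-- The coordinates on the space of matrices. -/
def matrixCoords : Coords (Matrix Λ Λ ℂ) (Λ × Λ) where
  toFun :=
    { toFun := fun M lk => M lk.1 lk.2
      map_add' := fun _ _ => rfl
      map_smul' := fun _ _ => rfl
      cont := continuous_pi fun lk => continuous_id.matrix_elem lk.1 lk.2 }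
  retr :=
    { toFun := fun M => Matrix.of (Function.curry M)
      map_add' := fun _ _ => rfl
      map_smul' := fun _ _ => rfl
      cont := continuous_matrix fun l k => continuous_apply (l, k) }
  retr_toFun _ := rfl

theorem isSmoothEmbedding_formChart : IsSmoothEmbedding (fun q : FrameIdx m Λ => formChart q)
    (fun ρ => (ρ.1 : Matrix Λ Λ ℂ)) where
  embedding := HForm.isEmbedding_val
  smooth := by
    refine ⟨HForm.continuous_val.continuousOn, fun q _ => ?_⟩
    refine (matrixCoords Λ).smoothOn ((formChart q).isOpen_inter_preimage_symm
      (isOpen_univ.inter (isOpen_univ.preimage HForm.continuous_val))) fun lk => ?_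
    exact cylSmoothOn_formChart_symm q inter_subset_left lk.1 lk.2
  extend q ρ hρ := by
    have hopen : IsOpen {M : Matrix Λ Λ ℂ | (gramMat M q.toChartIdx.frame).det ≠ 0} :=
      isOpen_ne_fun (Continuous.matrix_det (continuous_matrix fun i j => continuous_rhoInner _ _))
        continuous_const
    have hsource : ∀ σ ∈ (formChart q).source, σ.j ∈ (grChart q.toChartIdx).source := fun σ hσ =>
      mem_formChart_source.1 hσ
    -- The chart extends to all matrices for which the Gram determinant of the chosen frame of the
    -- supplement is nonzero. This frame may differ from `q.v` but has the same span.
    refine ⟨_, hopen, HForm.j_mem_chartDomain_iff.1 (mem_grChart_source.1 (hsource ρ hρ)),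
      chartFun q.toChartIdx q.v, ?_, fun σ hσ _ => ?_⟩
    · have := (matrixCoords Λ).isTopologicalAddGroup
      have := (matrixCoords Λ).continuousSMul
      exact smoothOn_chartFun (M := fun M => M) q.toChartIdx q.v hopen
        (fun l k => (matrixCoords Λ).cylSmoothOn (l, k) _) fun _ hM => hM
    · exact (baseChart_frameTrivialization (mem_formChart_source.1 hσ) (hsource σ hσ)).symm

theorem smoothMapOn_frameTrivialization (v : Fin m → Λ →₀ ℂ) :
    SmoothMapOn (fun q : FrameIdx m Λ => formChart q)
      (prodCharts (fun p : ChartIdx m Λ => grChart p) fun _ : Unit => coneChart m)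
      (frameTrivialization v) (frameTrivialization v).source := by
  refine ⟨(frameTrivialization v).continuousOn_toFun, fun q p => ?_⟩
  refine smoothOn_baseChart_frameTrivialization p.1 v ?_
    (cylSmoothOn_formChart_symm q inter_subset_left) (fun t ht => ht.2.1) fun t ht => ht.2.2.1
  exact (formChart q).isOpen_inter_preimage_symm
    ((frameTrivialization v).continuousOn_toFun.isOpen_inter_preimage
      (frameTrivialization v).open_source (baseChart p.1).open_source)

theorem smoothMapOn_frameTrivialization_symm (v : Fin m → Λ →₀ ℂ) :
    SmoothMapOn (prodCharts (fun p : ChartIdx m Λ => grChart p) fun _ : Unit => coneChart m)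
      (fun q : FrameIdx m Λ => formChart q) (frameTrivialization v).toOpenPartialHomeomorph.symm
      (frameTrivialization v).target := by
  refine ⟨(frameTrivialization v).continuousOn_invFun, fun p q => ?_⟩
  refine smoothOn_formChart q ?_ (cylSmoothOn_frameTrivialization_symm p.1 v inter_subset_left
    fun t ht => ht.2.1.1) fun t ht => ht.2.2
  exact (baseChart p.1).isOpen_inter_preimage_symm
    ((frameTrivialization v).continuousOn_invFun.isOpen_inter_preimage
      (frameTrivialization v).open_target (formChart q).open_source)

end Fibration

end

theorem proposition3p1 (Λ : Type u) [Countable Λ] (m : ℕ) :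
    -- the charts of the Grassmannian, as graphs of linear maps
    ∃ φ : ∀ p : ChartIdx m Λ, OpenPartialHomeomorph (Gr m Λ) p.Model,
      (∀ p, (φ p).source = chartDomain p.J' ∧ (φ p).target = univ ∧
        ∀ K ∈ (φ p).source,
          (perp K.1 : Set (Λ → ℂ)) =
            range fun ξ : perp p.J.1 => (ξ : Λ → ℂ) + ((φ p K).toCLM ξ : Λ → ℂ)) ∧
      IsFrechetManifold φ ∧
      -- the quotients form a vector bundle of dimension `m`
      (∃ (_ : TopologicalSpace (TotalSpace (Fin m → ℂ) (quotFiber m Λ)))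
          (_ : ∀ J, TopologicalSpace (quotFiber m Λ J))
          (_ : FiberBundle (Fin m → ℂ) (quotFiber m Λ))
          (_ : VectorBundle ℂ (Fin m → ℂ) (quotFiber m Λ)),
        IsSmoothVectorBundle φ (Fin m → ℂ) (quotFiber m Λ) ∧
        ∀ v : Fin m → (Λ →₀ ℂ), LinearIndependent ℂ v →
          ∃ e ∈ FiberBundle.trivializationAtlas (Fin m → ℂ) (quotFiber m Λ),
            e.baseSet = chartDomain (Submodule.span ℂ (range v)) ∧
            ∀ J ∈ e.baseSet, ∀ x : Fin m → ℂ,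
              e ⟨J, Submodule.Quotient.mk (∑ i, x i • v i)⟩ = (J, x)) ∧
      -- the fiber of `j` over `J` is the open cone of non-degenerate positive Hermitian forms
      (∀ J : Gr m Λ,
        Module.finrank ℝ (HermForm (quotFiber m Λ J)) = m ^ 2 ∧
        IsOpen (posCone (quotFiber m Λ J)) ∧
        Convex ℝ (posCone (quotFiber m Λ J)) ∧
        (∀ t : ℝ, 0 < t → ∀ h ∈ posCone (quotFiber m Λ J), t • h ∈ posCone (quotFiber m Λ J)) ∧
        ∃ Ψ : {ρ : HForm m Λ // ρ.j = J} ≃ₜ posCone (quotFiber m Λ J),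
          ∀ ρ a b, (Ψ ρ).1.1 (Submodule.Quotient.mk a) (Submodule.Quotient.mk b) =
            rhoInner ρ.1.1 a b) ∧
      -- `j` is a smooth locally trivial fibration of Fréchet manifolds
      ∃ (ψ : ∀ q : FrameIdx m Λ,
            OpenPartialHomeomorph (HForm m Λ) (q.toChartIdx.Model × HermForm (Fin m → ℂ)))
        (χ : OpenPartialHomeomorph (posCone (Fin m → ℂ)) (HermForm (Fin m → ℂ))),
        IsFrechetManifold ψ ∧
        IsSmoothEmbedding ψ (fun ρ => (ρ.1 : Matrix Λ Λ ℂ)) ∧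
        IsFrechetManifold (fun _ : Unit => χ) ∧
        (χ.source = univ ∧ χ.target = posCone (Fin m → ℂ) ∧ ∀ h, χ h = h.1) ∧
        (∀ J : Gr m Λ, ∃ v : Fin m → (Λ →₀ ℂ), LinearIndependent ℂ v ∧
          J ∈ chartDomain (Submodule.span ℂ (range v))) ∧
        ∀ v : Fin m → (Λ →₀ ℂ), LinearIndependent ℂ v →
          ∃ e : Trivialization (posCone (Fin m → ℂ)) (HForm.j : HForm m Λ → Gr m Λ),
            e.baseSet = chartDomain (Submodule.span ℂ (range v)) ∧
            (∀ ρ ∈ e.source, ∀ x y : Fin m → ℂ,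
              (e ρ).2.1.1 x y = rhoInner ρ.1 (∑ i, x i • v i) (∑ i, y i • v i)) ∧
            SmoothMapOn ψ (prodCharts φ fun _ : Unit => χ) e e.source ∧
            SmoothMapOn (prodCharts φ fun _ : Unit => χ) ψ e.toOpenPartialHomeomorph.symm
              e.target := by
  refine ⟨fun p => grChart p, fun p => ⟨grChart_source p, grChart_target p,
      fun K hK => perp_eq_range_graph hK⟩, isFrechetManifold_grChart, exists_quotient_bundle Λ m,
    fun J => ?_, fun q => formChart q, coneChart m, isFrechetManifold_formChart,
    isSmoothEmbedding_formChart, isFrechetManifold_coneChart,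
    ⟨coneChart_source, coneChart_target, coneChart_apply⟩, fun J => ?_, fun v _ => ?_⟩
  · have := J.2.1
    have b := Module.finBasisOfFinrankEq ℂ (quotFiber m Λ J) J.2.2
    exact ⟨HermForm.finrank_eq b, isOpen_posCone b, convex_posCone,
      fun t ht h hh => smul_mem_posCone ht hh, fiberHomeomorph J, fiberHomeomorph_apply J⟩
  · obtain ⟨v, hv, hJ, -⟩ := J.exists_mem_chartDomain
    exact ⟨v, hv, hJ⟩
  · refine ⟨frameTrivialization v, rfl, fun ρ hρ x y => ?_, smoothMapOn_frameTrivialization v,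
      smoothMapOn_frameTrivialization_symm v⟩
    change (ρ.coneForm v).1.1 x y = _
    rw [HForm.coe_coneForm hρ, HForm.gramForm_apply, combine_apply, combine_apply]
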